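/- Consider $N$ qubits, each with orthonormal basis $|+\rangle,|-\rangle$ and free Hamiltonian $\omega|+\rangle\langle+|$, $\omega>0$. For an integer $0\le K\le N$ and $0<\Delta<\omega$ let $\mathcal H_S\subset(\mathbb C^2)^{\otimes N}$ be the energy shell spanned by the eigenvectors of the total Hamiltonian with energy in $[K\omega,K\omega+\Delta)$, i.e. by the product vectors with $K$ factors $|+\rangle$ and $N-K$ factors $|-\rangle$. Let $|\Psi\rangle=U|\psi_0\rangle$, where $|\psi_0\rangle\in\mathcal H_S$ is a unit vector and $U$ is distributed according to the normalized Haar measure of the unitary group of $\mathcal H_S$. Let $\rho_A=\mathcal E_r^{\otimes N}(|\Psi\rangle\langle\Psi|)$, where $\mathcal E_r$ is the amplitude damping channel with Kraus operators $K_1=|-\rangle\langle-|+\sqrt{1-r}\,|+\rangle\langle+|$ and $K_2=\sqrt r\,|-\rangle\langle+|$, and let $R_2=-\ln\mathrm{Tr}\,\rho_A^2$ be the second Rényi entropy. Write an overline for the average over $U$, and $\sigma$ for the standard deviation of $\mathrm{Tr}\,\rho_A^2$ over $U$. Then for all fixed $u\in[0,1]$ and $r\in[0,1]$ the second Rényi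 entropy is typical in the limit $N\to\infty$ with $K=uN$: there are constants $c,C>0$, and for every $\varepsilon>0$ a constant $D_\varepsilon$, depending only on $u$ and $r$ (and $D_\varepsilon$ also on $\varepsilon$), such that for all $N$ and $K$ with $K=uN$, $$\frac{\sigma}{\overline{\mathrm{Tr}\,\rho_A^2}}\le C e^{-cN},\qquad \Bigl|\overline{R_2}-\bigl(-\ln\overline{\mathrm{Tr}\,\rho_A^2}\bigr)\Bigr|\le C e^{-cN},$$ and $$\Pr\bigl(|R_2-\overline{R_2}|\ge\varepsilon\bigr)\le D_\varepsilon e^{-cN}\quad\text{for every }\varepsilon>0 .$$ -/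

import Mathlib

open scoped Matrix

namespace QubitDissipation

/-- Computational-basis configurations of `N` qubits: `s n = 1` means that qubit `n` is in the
excited state `|+⟩`, and `s n = 0` that it is in the ground state `|-⟩`. -/
abbrev Config (N : ℕ) : Type := Fin N → Fin 2

/-- The Hilbert space `(ℂ²)^{⊗N}` of `N` qubits, with the product vectors as orthonormal basis. -/
abbrev QubitSpace (N : ℕ) : Type := EuclideanSpace ℂ (Config N)

/-- Operators on the Hilbert space of `N` qubits, as matrices in the product basis. -/
abbrev Operator (N : ℕ) : Type := Matrix (Config N) (Config N) ℂ

/-- The tensor product `A 0 ⊗ A 1 ⊗ ⋯ ⊗ A (N - 1)` of single-qubit operators. -/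
def tensor {N : ℕ} (A : Fin N → Matrix (Fin 2) (Fin 2) ℂ) : Operator N :=
  Matrix.of fun s t => ∏ n, A n (s n) (t n)

/-- The projection `|+⟩⟨+|` of a single qubit. -/
def excited : Matrix (Fin 2) (Fin 2) ℂ := !![0, 0; 0, 1]

/-- The free Hamiltonian `∑ₙ ω |+⟩⟨+|ₙ` of `N` qubits. -/
noncomputable def hamiltonian (N : ℕ) (ω : ℝ) : Operator N :=
  ∑ n : Fin N, tensor (Function.update (fun _ => 1) n ((ω : ℂ) • excited))

/-- The energy shell `[E, E + Δ)`: the span of the eigenvectors of the Hamiltonian whose energy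
lies in this interval. -/
noncomputable def energyShell (N : ℕ) (ω E Δ : ℝ) : Submodule ℂ (QubitSpace N) :=
  ⨆ x ∈ Set.Ico E (E + Δ),
    Module.End.eigenspace (Matrix.toEuclideanLin (hamiltonian N ω)) (x : ℂ)

/-- The group of unitary operators of a Hilbert space. -/
abbrev UnitaryGroup (H : Type*) [NormedAddCommGroup H] [InnerProductSpace ℂ H] [CompleteSpace H] :
    Type _ :=
  unitary (H →L[ℂ] H)

instance compactSpace_unitaryGroup (H : Type*) [NormedAddCommGroup H] [InnerProductSpace ℂ H]
    [CompleteSpace H] [FiniteDimensional ℂ H] : CompactSpace (UnitaryGroup H) := by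
  have : ProperSpace (H →L[ℂ] H) := FiniteDimensional.proper ℂ (H →L[ℂ] H)
  refine isCompact_iff_compactSpace.mp
    (Metric.isCompact_of_isClosed_isBounded (isClosed_unitary (R := H →L[ℂ] H)) ?_)
  refine (Metric.isBounded_iff_subset_closedBall (0 : H →L[ℂ] H)).2 ⟨1, fun U hU => ?_⟩
  rw [mem_closedBall_zero_iff]
  rcases subsingleton_or_nontrivial (H →L[ℂ] H) with h | h
  · rw [Subsingleton.elim U 0, norm_zero]
    exact zero_le_one
  · exact (CStarRing.norm_of_mem_unitary hU).le

/-- The normalized Haar measure of the unitary group of a finite-dimensional Hilbert space. -/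
noncomputable def haar (H : Type*) [NormedAddCommGroup H] [InnerProductSpace ℂ H]
    [CompleteSpace H] [FiniteDimensional ℂ H] : MeasureTheory.Measure (UnitaryGroup H) :=
  MeasureTheory.Measure.haarMeasure ⊤

instance isProbabilityMeasure_haar (H : Type*) [NormedAddCommGroup H] [InnerProductSpace ℂ H]
    [CompleteSpace H] [FiniteDimensional ℂ H] : MeasureTheory.IsProbabilityMeasure (haar H) :=
  ⟨by simpa [haar] using MeasureTheory.Measure.haarMeasure_self (G := UnitaryGroup H) (K₀ := ⊤)⟩

/-- The two Kraus operators of the amplitude damping channel with emission probability `r`: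
`|-⟩⟨-| + √(1-r) |+⟩⟨+|` and `√r |-⟩⟨+|`. -/
noncomputable def dampingKraus (r : ℝ) : Fin 2 → Matrix (Fin 2) (Fin 2) ℂ :=
  ![!![1, 0; 0, (Real.sqrt (1 - r) : ℂ)], !![0, (Real.sqrt r : ℂ); 0, 0]]

/-- The `N`-fold tensor power of the amplitude damping channel, through its Kraus operators, the
tensor products of the single-qubit Kraus operators. -/
noncomputable def dampingChannel (N : ℕ) (r : ℝ) (ρ : Operator N) : Operator N :=
  ∑ k : Fin N → Fin 2,
    tensor (fun n => dampingKraus r (k n)) * ρ * (tensor fun n => dampingKraus r (k n))ᴴ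

/-- The rank-one operator `|ψ⟩⟨ψ|`. -/
def pureState {N : ℕ} (ψ : QubitSpace N) : Operator N :=
  Matrix.vecMulVec ψ.ofLp (star ψ.ofLp)

/-- The output state `ρ_A` for the random initial state `U ψ₀ ∈ S`. -/
noncomputable def outputState {N : ℕ} (S : Submodule ℂ (QubitSpace N)) (ψ₀ : S) (r : ℝ)
    (U : UnitaryGroup S) : Operator N :=
  dampingChannel N r (pureState (U.1 ψ₀ : QubitSpace N))

/-- `Tr ρ²`. -/
noncomputable def purity {N : ℕ} (ρ : Operator N) : ℝ := (ρ ^ 2).trace.re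

/-- The second Rényi entropy `-ln Tr ρ²`. -/
noncomputable def renyiTwo {N : ℕ} (ρ : Operator N) : ℝ := -Real.log (purity ρ)

/-- The ensemble average of `Tr ρ_A²` over the Haar measure of the unitary group of `S`. -/
noncomputable def meanPurity {N : ℕ} (S : Submodule ℂ (QubitSpace N)) (ψ₀ : S) (r : ℝ) : ℝ :=
  ∫ U, purity (outputState S ψ₀ r U) ∂(haar S)

/-- The standard deviation of `Tr ρ_A²` over the Haar measure of the unitary group of `S`. -/
noncomputable def sdPurity {N : ℕ} (S : Submodule ℂ (QubitSpace N)) (ψ₀ : S) (r : ℝ) : ℝ :=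
  Real.sqrt (ProbabilityTheory.variance (fun U => purity (outputState S ψ₀ r U)) (haar S))

/-- The ensemble average of the second Rényi entropy of `ρ_A` over the Haar measure of the unitary
group of `S`. -/
noncomputable def meanRenyiTwo {N : ℕ} (S : Submodule ℂ (QubitSpace N)) (ψ₀ : S) (r : ℝ) : ℝ :=
  ∫ U, renyiTwo (outputState S ψ₀ r U) ∂(haar S)

end QubitDissipation

namespace QubitDissipation

open MeasureTheory ComplexConjugate

/-! ### Haar measure on the unitary group and orbit averages. -/

section HaarUnitary

variable {H : Type*} [NormedAddCommGroup H] [InnerProductSpace ℂ H]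
  [CompleteSpace H] [FiniteDimensional ℂ H]

/-! The output purity is a quartic form in the coordinates of a Haar-random vector of the shell, and
its coefficients are products over the qubits. Haar moments of coordinates are complex Gaussian
moments up to normalisation (`integral_haar_monomial`). Hence, with d = C(N,K) the dimension of the
shell, the first two moments of the purity are sums over permutations of two and of four indices.

For the second moment the 24 permutations fall into three classes (`sum_quarticPairing`). Four keep
the two copies of the form apart and give 4t², with t the pair trace; this is the squared mean to
leading order. Sixteen link the copies through a partial trace. That partial trace is diagonal, and
constant on the diagonal because permutations of the qubits act transitively on the shell
configurations; these terms give 16t²/d (`card_mul_sum_partialTrace`). The last four interchange the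
copies and give 4Q, where Q sums the squares of the symmetrized kernel. Put g = ((1-r)²+r²)^K and m
= min(K, N-K). Site-by-site summation gives Q ≤ d²g² (`sum_shellKernel_sq_le`), and
`le_kernel_add_kernel` gives 2t ≥ d²g/2^m. Since (2m+1)d ≥ 4^m, Q/t² is at most 4(2m+1)/d, and the
relative variance is at most 35(2m+1)²/4^m (`variance_purity_le`).

To pass to the logarithm, let p be the purity divided by its mean. The purity is at least 2^(-N) and
its mean at most 2, so p ≥ exp(-(N+1)) always, and then -log p + p - 1 is at most O(N)(p-1)².
Because p has mean 1, averaging bounds the Jensen gap; a first-moment bound and Markov's inequality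
give the probability estimate (`log_concentration`, `measureReal_deviation_le`).

If u is 0 or 1 then m = 0 and these estimates do not decay, but the shell is one-dimensional and
nothing fluctuates. -/

instance isHaarMeasure_haar : (haar H).IsHaarMeasure := by
  unfold haar; infer_instance

/-- A right translate of a Haar probability measure is again one, so uniqueness applies. Right
invariance lets the reference vector be moved freely on the unit sphere. -/
instance isMulRightInvariant_haar : (haar H).IsMulRightInvariant := by
  constructor
  intro V
  have : IsProbabilityMeasure ((haar H).map (· * V)) :=
    Measure.isProbabilityMeasure_map (by fun_prop)
  have : ((haar H).map (· * V)).IsHaarMeasure := by infer_instance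
  exact Measure.isHaarMeasure_eq_of_isProbabilityMeasure _ _

/-- The unitary group acts transitively on the unit sphere. -/
theorem exists_unitary_apply_eq {x y : H} (hx : ‖x‖ = 1) (hy : ‖y‖ = 1) :
    ∃ V : UnitaryGroup H, V.1 x = y := by
  have key : ∀ z : H, ‖z‖ = 1 →
      ∃ b : OrthonormalBasis (Fin (Module.finrank ℂ H)) ℂ H, ∃ i, i.1 = 0 ∧ b i = z := by
    intro z hz
    have hpos : 0 < Module.finrank ℂ H := by
      have : Nontrivial H := ⟨z, 0, fun h => by simp [h] at hz⟩
      exact Module.finrank_pos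
    have hon : Orthonormal ℂ (({⟨0, hpos⟩} : Set (Fin (Module.finrank ℂ H))).domRestrict
        (fun _ => z)) := by
      constructor
      · intro i; simpa using hz
      · rintro ⟨i, hi⟩ ⟨j, hj⟩ hij
        exact absurd (Subtype.ext (hi.trans hj.symm)) hij
    obtain ⟨b, hb⟩ := hon.exists_orthonormalBasis_extension_of_card_eq (by simp)
    exact ⟨b, ⟨0, hpos⟩, rfl, hb _ rfl⟩
  obtain ⟨b, i, hi, hbx⟩ := key x hx
  obtain ⟨c, j, hj, hcy⟩ := key y hy
  obtain rfl : i = j := Fin.ext (hi.trans hj.symm)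
  refine ⟨Unitary.linearIsometryEquiv.symm (b.equiv c (Equiv.refl _)), ?_⟩
  rw [← hbx, ← hcy]
  simp

theorem integral_haar_apply_eq (F : H → ℂ) {x y : H} (hx : ‖x‖ = 1) (hy : ‖y‖ = 1) :
    ∫ U : UnitaryGroup H, F (U.1 y) ∂(haar H) = ∫ U : UnitaryGroup H, F (U.1 x) ∂(haar H) := by
  obtain ⟨V, rfl⟩ := exists_unitary_apply_eq hx hy
  exact integral_mul_right_eq_self (μ := haar H) (fun U : UnitaryGroup H => F (U.1 x)) V

/-- Averages of homogeneous functions over the orbit of a vector. -/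
theorem integral_haar_apply_of_homogeneous (F : H → ℂ) (m : ℕ)
    (hF : ∀ (c : ℝ) (v : H), F ((c : ℂ) • v) = (c : ℂ) ^ m * F v) {x : H} (hx : ‖x‖ = 1) (v : H) :
    ∫ U : UnitaryGroup H, F (U.1 v) ∂(haar H)
      = (‖v‖ : ℂ) ^ m * ∫ U : UnitaryGroup H, F (U.1 x) ∂(haar H) := by
  obtain ⟨w, hw, hv⟩ : ∃ w : H, ‖w‖ = 1 ∧ v = (‖v‖ : ℂ) • w := by
    rcases eq_or_ne v 0 with rfl | hv
    · exact ⟨x, hx, by simp⟩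
    · refine ⟨(‖v‖ : ℂ)⁻¹ • v, ?_, ?_⟩
      · rw [norm_smul]; simp [hv]
      · rw [smul_smul, mul_inv_cancel₀ (by simpa using hv), one_smul]
  rw [← integral_haar_apply_eq F hx hw, ← integral_const_mul]
  congr 1
  ext U
  rw [← hF, ← map_smul, ← hv]

end HaarUnitary

/-! ### Moments of the complex Gaussian weight in one variable. -/

section Gaussian

theorem integral_norm_pow_mul_exp (k : ℕ) :
    ∫ z : ℂ, ‖z‖ ^ (2 * k) * Real.exp (-‖z‖ ^ 2) = Real.pi * (k.factorial : ℝ) := by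
  have h := Complex.integral_rpow_mul_exp_neg_rpow (p := 2) (q := (2 * k : ℕ)) (by norm_num)
    (by have : (0 : ℝ) ≤ (2 * k : ℕ) := by positivity
        linarith)
  simp only [Real.rpow_natCast, Real.rpow_two] at h
  rw [h, show (((2 * k : ℕ) : ℝ) + 2) / 2 = (k : ℝ) + 1 by push_cast; ring,
    Real.Gamma_nat_eq_factorial]
  ring

theorem integrable_norm_pow_mul_exp (k : ℕ) :
    Integrable (fun z : ℂ => ‖z‖ ^ k * Real.exp (-‖z‖ ^ 2)) := by
  have key : ∀ k : ℕ, Integrable (fun z : ℂ => ‖z‖ ^ (2 * k) * Real.exp (-‖z‖ ^ 2)) := by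
    intro k
    refine Integrable.of_integral_ne_zero ?_
    rw [integral_norm_pow_mul_exp]
    positivity
  refine ((key 0).add (key k)).mono' (by fun_prop) (Filter.Eventually.of_forall fun z => ?_)
  have h0 : (0 : ℝ) ≤ ‖z‖ := norm_nonneg z
  rw [Real.norm_of_nonneg (by positivity)]
  simp only [Pi.add_apply, ← add_mul]
  refine mul_le_mul_of_nonneg_right ?_ (Real.exp_pos _).le
  rcases le_total ‖z‖ 1 with h | h
  · calc ‖z‖ ^ k ≤ 1 := pow_le_one₀ h0 h
      _ ≤ _ := by simp
  · calc ‖z‖ ^ k ≤ ‖z‖ ^ (2 * k) := pow_le_pow_right₀ h (by omega)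
      _ ≤ _ := by simp

theorem integrable_pow_mul_conj_pow_mul_exp (m n : ℕ) :
    Integrable (fun z : ℂ => z ^ m * conj z ^ n * (Real.exp (-‖z‖ ^ 2) : ℂ)) := by
  refine (integrable_norm_pow_mul_exp (m + n)).mono' (by fun_prop)
    (Filter.Eventually.of_forall fun z => ?_)
  simp [pow_add, Complex.norm_exp]
  norm_cast

/-- The moments of the complex Gaussian weight. -/
theorem integral_pow_mul_conj_pow_mul_exp (m n : ℕ) :
    ∫ z : ℂ, z ^ m * conj z ^ n * (Real.exp (-‖z‖ ^ 2) : ℂ)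
      = if m = n then (Real.pi : ℂ) * n.factorial else 0 := by
  split_ifs with h
  · subst h
    have := integral_norm_pow_mul_exp m
    rw [show (Real.pi : ℂ) * m.factorial = ((Real.pi * (m.factorial : ℝ) : ℝ) : ℂ) by
      push_cast; ring, ← this, ← integral_complex_ofReal]
    congr 1
    ext z
    rw [← mul_pow, Complex.mul_conj, Complex.normSq_eq_norm_sq, pow_mul]
    push_cast
    ring
  · set I := ∫ z : ℂ, z ^ m * conj z ^ n * (Real.exp (-‖z‖ ^ 2) : ℂ) with hI
    -- Rotating by c multiplies the integral by c^(m-n), so one phase with c^(m-n) ≠ 1 forces it to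
    -- vanish. The phase exp(i) works for every m ≠ n because π is irrational.
    obtain ⟨c, hc⟩ : ∃ c : Circle, (c : ℂ) ^ m * conj (c : ℂ) ^ n ≠ 1 := by
      refine ⟨Circle.exp 1, fun h1 => h ?_⟩
      have h2 : Complex.exp (((m : ℂ) - n) * Complex.I) = 1 := by
        rw [← h1, Circle.coe_exp, ← Complex.exp_conj, ← Complex.exp_nat_mul, ← Complex.exp_nat_mul,
          ← Complex.exp_add]
        congr 1
        simp
        ring
      obtain ⟨k, hk⟩ := Complex.exp_eq_one_iff.1 h2
      have hk' : ((m : ℤ) - n : ℝ) = k * (2 * Real.pi) := by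
        have := congrArg Complex.im hk
        simpa using this
      have hk0 : k = 0 := by
        by_contra hk0
        apply irrational_pi
        refine ⟨((m : ℚ) - n) / (2 * k), ?_⟩
        have : (k : ℝ) ≠ 0 := by exact_mod_cast hk0
        push_cast
        field_simp
        push_cast at hk'
        linarith
      rw [hk0] at hk'
      have : (m : ℝ) = n := by push_cast at hk'; linarith
      exact_mod_cast this
    have hrot : I = ((c : ℂ) ^ m * conj (c : ℂ) ^ n) * I := by
      conv_lhs => rw [hI, ← (rotation c).measurePreserving.integral_comp
        (rotation c).toHomeomorph.measurableEmbedding]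
      rw [hI, ← integral_const_mul]
      congr 1
      ext z
      simp only [rotation_apply, map_mul, mul_pow, norm_mul, Circle.norm_coe, one_mul]
      ring
    have : (1 - (c : ℂ) ^ m * conj (c : ℂ) ^ n) * I = 0 := by linear_combination hrot
    exact (mul_eq_zero.1 this).resolve_left (sub_ne_zero.2 hc.symm)

end Gaussian

/-! ### Permutations carrying one index tuple to another. -/

section Counting

variable {κ ι : Type*} [Fintype κ] [DecidableEq κ] [DecidableEq ι]

omit [DecidableEq κ] in
/-- Two functions with equinumerous fibres differ by a permutation of the source. -/
theorem exists_perm_comp_eq {x y : κ → ι}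
    (h : ∀ a, Fintype.card {k // x k = a} = Fintype.card {k // y k = a}) :
    ∃ σ : Equiv.Perm κ, x ∘ σ = y := by
  refine ⟨(Equiv.sigmaFiberEquiv y).symm.trans ((Equiv.sigmaCongrRight fun a =>
    (Fintype.equivOfCardEq (h a)).symm).trans (Equiv.sigmaFiberEquiv x)), ?_⟩
  ext k
  exact (Fintype.equivOfCardEq (h (y k))).symm ⟨k, rfl⟩ |>.2

/-- The number of permutations carrying one index tuple to another. -/
def matchings (x y : κ → ι) : ℕ := Fintype.card {σ : Equiv.Perm κ // x ∘ σ = y}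

theorem matchings_eq [Fintype ι] (x y : κ → ι) :
    matchings x y = ∏ a, if Fintype.card {k // x k = a} = Fintype.card {k // y k = a}
      then (Fintype.card {k // y k = a}).factorial else 0 := by
  by_cases h : ∀ a, Fintype.card {k // x k = a} = Fintype.card {k // y k = a}
  · obtain ⟨σ, rfl⟩ := exists_perm_comp_eq h
    simp only [h, if_true]
    -- The admissible permutations form a coset of the stabilizer of the tuple, whose order is the
    -- product of the factorials of the fibre sizes.
    rw [← DomMulAct.stabilizer_card, matchings]
    refine Fintype.card_congr ⟨fun τ => ⟨σ⁻¹ * τ.1, ?_⟩, fun τ => ⟨σ * τ.1, ?_⟩, ?_, ?_⟩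
    · ext k; simpa using congrFun τ.2 k
    · ext k; simpa using congrFun τ.2 k
    · intro τ; ext; simp
    · intro τ; ext; simp
  · obtain ⟨a, ha⟩ := not_forall.1 h
    rw [Finset.prod_eq_zero (Finset.mem_univ a) (by simp [ha]), matchings, Fintype.card_eq_zero_iff]
    refine ⟨fun σ => ha ?_⟩
    obtain ⟨σ, rfl⟩ := σ
    exact (Fintype.card_congr (σ.subtypeEquiv fun k => by simp)).symm

end Counting

/-! ### From Gaussian moments to Haar moments. -/

section Moments

variable {κ ι : Type*} [Fintype κ] [DecidableEq κ] [Fintype ι] [DecidableEq ι]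

omit [DecidableEq κ] in
theorem prod_comp_eq_prod_pow {M : Type*} [CommMonoid M] (x : κ → ι) (f : ι → M) :
    ∏ k, f (x k) = ∏ a, f a ^ Fintype.card {k // x k = a} := by
  rw [← Finset.prod_fiberwise (s := Finset.univ) (g := x)]
  refine Finset.prod_congr rfl fun a _ => ?_
  rw [Finset.prod_congr rfl (g := fun _ => f a)
    (fun k hk => by rw [(Finset.mem_filter.1 hk).2]), Finset.prod_const, Fintype.card_subtype]

/-- The monomial `∏ z_{x k} conj z_{y k}`. -/
noncomputable def monomial (x y : κ → ι) (z : ι → ℂ) : ℂ := ∏ k, (z (x k) * conj (z (y k)))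

/-- The Gaussian weight. -/
noncomputable def gaussWeight (z : ι → ℂ) : ℂ := ∏ a, (Real.exp (-‖z a‖ ^ 2) : ℂ)

omit [DecidableEq ι] in
theorem gaussWeight_eq (z : ι → ℂ) : gaussWeight z = (Real.exp (-∑ a, ‖z a‖ ^ 2) : ℂ) := by
  simp [gaussWeight, ← Finset.sum_neg_distrib, Complex.exp_sum]

omit [DecidableEq κ] in
theorem monomial_mul_gaussWeight (x y : κ → ι) (z : ι → ℂ) :
    monomial x y z * gaussWeight z = ∏ a, (z a ^ Fintype.card {k // x k = a}
      * conj (z a) ^ Fintype.card {k // y k = a} * (Real.exp (-‖z a‖ ^ 2) : ℂ)) := by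
  rw [monomial, gaussWeight, Finset.prod_mul_distrib, Finset.prod_mul_distrib,
    Finset.prod_mul_distrib, prod_comp_eq_prod_pow x z, prod_comp_eq_prod_pow y (fun a => conj (z a))]

omit [DecidableEq κ] in
theorem integrable_monomial_mul_gaussWeight (x y : κ → ι) :
    Integrable (fun z : ι → ℂ => monomial x y z * gaussWeight z) := by
  simp only [monomial_mul_gaussWeight]
  exact Integrable.fintype_prod (f := fun a (z : ℂ) => z ^ Fintype.card {k // x k = a}
      * conj z ^ Fintype.card {k // y k = a} * (Real.exp (-‖z‖ ^ 2) : ℂ))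
    fun a => integrable_pow_mul_conj_pow_mul_exp _ _

/-- Wick's formula. -/
theorem integral_monomial_mul_gaussWeight (x y : κ → ι) :
    ∫ z : ι → ℂ, monomial x y z * gaussWeight z
      = (Real.pi : ℂ) ^ Fintype.card ι * matchings x y := by
  simp only [monomial_mul_gaussWeight]
  rw [integral_fintype_prod_volume_eq_prod (fun a (z : ℂ) => z ^ Fintype.card {k // x k = a}
      * conj z ^ Fintype.card {k // y k = a} * (Real.exp (-‖z‖ ^ 2) : ℂ)), matchings_eq]
  simp only [integral_pow_mul_conj_pow_mul_exp]
  push_cast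
  rw [← Finset.card_univ, ← Finset.prod_const, ← Finset.prod_mul_distrib]
  refine Finset.prod_congr rfl fun a _ => ?_
  split_ifs <;> simp

-- Diagonal monomials add up to a power of the squared norm; this fixes the normalisation of the
-- Haar moments and supplies the dominating function for Fubini.
omit [DecidableEq ι] in
theorem sum_monomial_self (z : ι → ℂ) :
    ∑ x : κ → ι, monomial x x z = ((∑ a, ‖z a‖ ^ 2 : ℝ) : ℂ) ^ Fintype.card κ := by
  rw [← Finset.card_univ, ← Finset.prod_const, Complex.ofReal_sum,
    Finset.prod_univ_sum]
  simp only [Fintype.piFinset_univ, monomial, Complex.mul_conj, Complex.normSq_eq_norm_sq]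

/-- Integrals over `ι → ℂ` are invariant under norm-preserving linear maps. -/
theorem integral_comp_of_norm_preserving (L : (ι → ℂ) ≃L[ℝ] (ι → ℂ))
    (hL : ∀ z, ∑ a, ‖L z a‖ ^ 2 = ∑ a, ‖z a‖ ^ 2) (G : (ι → ℂ) → ℂ) :
    ∫ z, G (L z) = ∫ z, G z := by
  have key : ∀ G : (ι → ℂ) → ℂ, ∫ z, G (L z)
      = (|(LinearMap.det (L : (ι → ℂ) →ₗ[ℝ] (ι → ℂ)))⁻¹| : ℝ) • ∫ z, G z := by
    intro G
    have h1 := Measure.map_linearMap_addHaar_eq_smul_addHaar (volume : Measure (ι → ℂ))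
      (f := (L : (ι → ℂ) →ₗ[ℝ] (ι → ℂ))) (LinearEquiv.isUnit_det' L.toLinearEquiv).ne_zero
    have h2 := integral_map_equiv (μ := volume) L.toHomeomorph.toMeasurableEquiv G
    have h3 : Measure.map L.toHomeomorph.toMeasurableEquiv (volume : Measure (ι → ℂ))
      = _ := h1
    rw [h3, integral_smul_measure, ENNReal.toReal_ofReal (abs_nonneg _)] at h2
    exact h2.symm
  -- The Jacobian is found by testing on the Gaussian weight, which the map preserves and whose
  -- integral is nonzero; no determinant has to be computed.
  have hw := key gaussWeight
  have hw' : ∀ z, gaussWeight (L z) = gaussWeight z := fun z => by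
    rw [gaussWeight_eq, gaussWeight_eq, hL]
  have hpos : ∫ z : ι → ℂ, gaussWeight z = (Real.pi : ℂ) ^ Fintype.card ι := by
    have := integral_monomial_mul_gaussWeight (ι := ι) (κ := Empty) Empty.elim Empty.elim
    simpa [monomial, matchings, Fintype.card_subtype, Subsingleton.elim _ (Empty.elim : Empty → ι)]
      using this
  simp only [hw'] at hw
  have h0 : (∫ z : ι → ℂ, gaussWeight z) ≠ 0 := by
    rw [hpos]; exact pow_ne_zero _ (by exact_mod_cast Real.pi_ne_zero)
  have h1 : (|(LinearMap.det (L : (ι → ℂ) →ₗ[ℝ] (ι → ℂ)))⁻¹| : ℝ) = 1 := by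
    rw [Complex.real_smul] at hw
    have := mul_right_cancel₀ h0 ((one_mul _).trans hw)
    exact_mod_cast this.symm
  rw [key, h1, one_smul]

variable {H : Type*} [NormedAddCommGroup H] [InnerProductSpace ℂ H]
  [CompleteSpace H] [FiniteDimensional ℂ H]

omit [DecidableEq κ] [DecidableEq ι] in
theorem norm_monomial_le (x y : κ → ι) (z : ι → ℂ) :
    ‖monomial x y z‖ ≤ (∑ a, ‖z a‖ ^ 2) ^ Fintype.card κ := by
  rw [monomial, norm_prod, ← Finset.card_univ, ← Finset.prod_const]
  refine Finset.prod_le_prod (fun _ _ => norm_nonneg _) fun k _ => ?_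
  have h1 : ∀ a, ‖z a‖ ^ 2 ≤ ∑ a, ‖z a‖ ^ 2 := fun a =>
    Finset.single_le_sum (f := fun a => ‖z a‖ ^ 2) (fun _ _ => by positivity) (Finset.mem_univ a)
  rw [norm_mul, RCLike.norm_conj]
  nlinarith [h1 (x k), h1 (y k), sq_nonneg (‖z (x k)‖ - ‖z (y k)‖)]

omit [DecidableEq ι] [CompleteSpace H] [FiniteDimensional ℂ H] in
theorem sum_norm_repr_sq (b : OrthonormalBasis ι ℂ H) (v : H) :
    ∑ a, ‖b.repr v a‖ ^ 2 = ‖v‖ ^ 2 := by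
  rw [← EuclideanSpace.norm_sq_eq, LinearIsometryEquiv.norm_map]

/-- The moments of the coordinates of a Haar random vector. -/
theorem integral_haar_monomial (b : OrthonormalBasis ι ℂ H) {ψ : H} (hψ : ‖ψ‖ = 1)
    (x y : κ → ι) :
    (∑ t : κ → ι, (matchings t t : ℂ))
      * ∫ U : UnitaryGroup H, monomial x y (b.repr (U.1 ψ)) ∂(haar H) = matchings x y := by
  set n := Fintype.card κ with hn
  let toH : (ι → ℂ) → H := fun z => b.repr.symm (WithLp.toLp 2 z)
  have hnorm : ∀ z, ‖toH z‖ ^ 2 = ∑ a, ‖z a‖ ^ 2 := fun z => by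
    rw [← sum_norm_repr_sq b]; simp [toH]
  have hcont : Continuous toH := by fun_prop
  have hmon : ∀ x y : κ → ι, Continuous (monomial x y) := fun x y => by
    unfold monomial; fun_prop
  have hgc : Continuous (gaussWeight : (ι → ℂ) → ℂ) := by unfold gaussWeight; fun_prop
  have hhom : ∀ (x y : κ → ι) (z : ι → ℂ), ∫ U : UnitaryGroup H, monomial x y (b.repr (U.1 (toH z))) ∂(haar H)
      = ((∑ a, ‖z a‖ ^ 2 : ℝ) : ℂ) ^ n
        * ∫ U : UnitaryGroup H, monomial x y (b.repr (U.1 ψ)) ∂(haar H) := by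
    intro x y z
    have := integral_haar_apply_of_homogeneous (fun v : H => monomial x y (b.repr v)) (2 * n)
      (fun c v => by
        simp only [monomial, map_smul, PiLp.smul_apply, smul_eq_mul, map_mul, Complex.conj_ofReal]
        rw [pow_mul, hn, ← Finset.card_univ, ← Finset.prod_const, ← Finset.prod_mul_distrib]
        exact Finset.prod_congr rfl fun k _ => by ring) hψ (toH z)
    rw [this, pow_mul, ← hnorm]
    push_cast
    rfl
  -- For fixed U the Gaussian integral does not see U. For fixed z, homogeneity of degree 2n splits
  -- the Haar average into a radial factor and the wanted moment. Fubini equates the two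
  -- evaluations.
  have hinv : ∀ (U : UnitaryGroup H) (x y : κ → ι), ∫ z : ι → ℂ, monomial x y (b.repr (U.1 (toH z)))
      * gaussWeight z = (Real.pi : ℂ) ^ Fintype.card ι * matchings x y := by
    intro U x y
    let E : (ι → ℂ) ≃ₗ[ℂ] H := (WithLp.linearEquiv 2 ℂ (ι → ℂ)).symm.trans
      b.repr.symm.toLinearEquiv
    let L : (ι → ℂ) ≃L[ℝ] (ι → ℂ) := (((E.trans
      (Unitary.linearIsometryEquiv U).toLinearEquiv).trans E.symm).restrictScalars
        ℝ).toContinuousLinearEquiv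
    have hL : ∀ z, L z = (b.repr (U.1 (toH z))).ofLp := fun z => rfl
    have hLn : ∀ z, ∑ a, ‖L z a‖ ^ 2 = ∑ a, ‖z a‖ ^ 2 := fun z => by
      rw [hL, sum_norm_repr_sq, ← hnorm]
      congr 1
      exact (Unitary.linearIsometryEquiv U).norm_map (toH z)
    rw [← integral_monomial_mul_gaussWeight, ← integral_comp_of_norm_preserving L hLn
      (fun z => monomial x y z * gaussWeight z)]
    refine integral_congr_ae (Filter.Eventually.of_forall fun z => ?_)
    simp only
    rw [← hL, gaussWeight_eq z, gaussWeight_eq (L z), hLn]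
  have hswap : ∀ x y : κ → ι, (∫ z : ι → ℂ, ((∑ a, ‖z a‖ ^ 2 : ℝ) : ℂ) ^ n * gaussWeight z)
      * ∫ U : UnitaryGroup H, monomial x y (b.repr (U.1 ψ)) ∂(haar H)
      = (Real.pi : ℂ) ^ Fintype.card ι * matchings x y := by
    intro x y
    have hint : Integrable (Function.uncurry fun (z : ι → ℂ) (U : UnitaryGroup H) =>
        monomial x y (b.repr (U.1 (toH z))) * gaussWeight z) (volume.prod (haar H)) := by
      have hdom : Integrable (fun z : ι → ℂ => ∑ t : κ → ι, monomial t t z * gaussWeight z) :=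
        integrable_finsetSum _ fun t _ => integrable_monomial_mul_gaussWeight t t
      refine (hdom.norm.comp_fst (haar H)).mono' ?_ (Filter.Eventually.of_forall ?_)
      · refine Continuous.aestronglyMeasurable ?_
        have h1 : Continuous fun p : (ι → ℂ) × UnitaryGroup H => p.2.1 (toH p.1) :=
          (continuous_subtype_val.comp continuous_snd).clm_apply (hcont.comp continuous_fst)
        have h2 : Continuous fun p : (ι → ℂ) × UnitaryGroup H =>
            (b.repr (p.2.1 (toH p.1))).ofLp := by fun_prop
        exact ((hmon x y).comp h2).mul (hgc.comp continuous_fst)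
      · rintro ⟨z, U⟩
        simp only [Function.uncurry]
        rw [← Finset.sum_mul, sum_monomial_self, norm_mul, norm_mul]
        refine mul_le_mul_of_nonneg_right ?_ (norm_nonneg _)
        refine (norm_monomial_le x y _).trans ?_
        rw [sum_norm_repr_sq]
        have : ‖U.1 (toH z)‖ = ‖toH z‖ := (Unitary.linearIsometryEquiv U).norm_map (toH z)
        rw [this, hnorm, norm_pow, Complex.norm_real, Real.norm_of_nonneg (by positivity)]
    have hf := integral_integral_swap hint
    simp only [hinv, integral_const, probReal_univ, one_smul] at hf
    rw [← hf, ← integral_mul_const]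
    congr 1
    ext z
    rw [integral_mul_const, hhom]
    ring
  have hsum : (∫ z : ι → ℂ, ((∑ a, ‖z a‖ ^ 2 : ℝ) : ℂ) ^ n * gaussWeight z)
      = (Real.pi : ℂ) ^ Fintype.card ι * ∑ t : κ → ι, (matchings t t : ℂ) := by
    simp only [hn, ← sum_monomial_self (κ := κ), Finset.sum_mul]
    rw [integral_finsetSum _ fun t _ => integrable_monomial_mul_gaussWeight t t, Finset.mul_sum]
    simp only [integral_monomial_mul_gaussWeight]
  have h := hswap x y
  rw [hsum, mul_assoc] at h
  exact mul_left_cancel₀ (pow_ne_zero _ (by exact_mod_cast Real.pi_ne_zero)) h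

end Moments

/-! ### Products and sums over sites. -/

section Tensor

variable {N : ℕ}

theorem tensor_mul (A B : Fin N → Matrix (Fin 2) (Fin 2) ℂ) :
    tensor A * tensor B = tensor fun n => A n * B n := by
  ext s t
  simp only [tensor, Matrix.mul_apply, Matrix.of_apply, ← Finset.prod_mul_distrib]
  rw [Finset.prod_univ_sum]
  simp

theorem tensor_conjTranspose (A : Fin N → Matrix (Fin 2) (Fin 2) ℂ) :
    (tensor A)ᴴ = tensor fun n => (A n)ᴴ := by
  ext s t
  simp [tensor, Matrix.conjTranspose_apply]

theorem sum_prod_site {R : Type*} [CommSemiring R] (f : Fin N → Fin 2 → R) :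
    ∑ k : Fin N → Fin 2, ∏ n, f n (k n) = ∏ n, ∑ j, f n j := by
  rw [Finset.prod_univ_sum]
  simp

end Tensor

/-! ### The output purity as a quartic form with a product kernel. -/

section Purity

/-- The single-qubit factor of the quartic form `Tr ρ_A²`. -/
def siteKernel (r : ℝ) (a b c d : Fin 2) : ℝ :=
  if a = b then
    if c = a ∧ d = a then (if a = 0 then 1 else (1 - r) ^ 2 + r ^ 2) else 0
  else if c = a ∧ d = b then 1 - r else if c = b ∧ d = a then r else 0

theorem sum_kraus_eq_siteKernel {r : ℝ} (hr : r ∈ Set.Icc (0 : ℝ) 1) (a b c d : Fin 2) :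
    ∑ k, ∑ l, ((dampingKraus r k)ᴴ * dampingKraus r l) c a
      * ((dampingKraus r l)ᴴ * dampingKraus r k) d b = (siteKernel r a b c d : ℂ) := by
  have h1 : (Real.sqrt (1 - r) : ℂ) * Real.sqrt (1 - r) = 1 - r := by
    rw [← Complex.ofReal_mul, Real.mul_self_sqrt (by linarith [hr.2])]; push_cast; rfl
  have h2 : (Real.sqrt r : ℂ) * Real.sqrt r = r := by
    rw [← Complex.ofReal_mul, Real.mul_self_sqrt hr.1]
  fin_cases a <;> fin_cases b <;> fin_cases c <;> fin_cases d <;>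
    simp [dampingKraus, Matrix.mul_apply, siteKernel, Fin.sum_univ_two, Matrix.conjTranspose_apply,
      h1, h2]
  ring

theorem sum_kraus_self {r : ℝ} (hr : r ∈ Set.Icc (0 : ℝ) 1) (c a : Fin 2) :
    ∑ k, ((dampingKraus r k)ᴴ * dampingKraus r k) c a = if c = a then 1 else 0 := by
  have h1 : (Real.sqrt (1 - r) : ℂ) * Real.sqrt (1 - r) = 1 - r := by
    rw [← Complex.ofReal_mul, Real.mul_self_sqrt (by linarith [hr.2])]; push_cast; rfl
  have h2 : (Real.sqrt r : ℂ) * Real.sqrt r = r := by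
    rw [← Complex.ofReal_mul, Real.mul_self_sqrt hr.1]
  fin_cases a <;> fin_cases c <;>
    simp [dampingKraus, Matrix.mul_apply, Fin.sum_univ_two, Matrix.conjTranspose_apply, h1, h2]

variable {N : ℕ}

/-- The kernel of the quartic form `Tr ρ_A²`. -/
def kernel (r : ℝ) (a b c d : Config N) : ℝ := ∏ n, siteKernel r (a n) (b n) (c n) (d n)

/-- The tensor product of Kraus operators with indices `k`. -/
noncomputable def krausTensor (r : ℝ) (k : Fin N → Fin 2) : Operator N :=
  tensor fun n => dampingKraus r (k n)

/-- The Gram matrix of the vectors obtained from `φ` by the Kraus operators. -/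
noncomputable def krausGram (r : ℝ) (φ : QubitSpace N) (k l : Fin N → Fin 2) : ℂ :=
  star (krausTensor r k *ᵥ φ.ofLp) ⬝ᵥ (krausTensor r l *ᵥ φ.ofLp)

theorem krausGram_eq_sum (r : ℝ) (φ : QubitSpace N) (k l : Fin N → Fin 2) :
    krausGram r φ k l = ∑ c, ∑ a, conj (φ c) * φ a
      * ∏ n, ((dampingKraus r (k n))ᴴ * dampingKraus r (l n)) (c n) (a n) := by
  rw [krausGram, Matrix.star_mulVec, ← Matrix.dotProduct_mulVec, Matrix.mulVec_mulVec,
    krausTensor, krausTensor, tensor_conjTranspose, tensor_mul]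
  simp only [dotProduct, Matrix.mulVec, tensor, Matrix.of_apply, Finset.mul_sum, Pi.star_apply]
  refine Finset.sum_congr rfl fun c _ => Finset.sum_congr rfl fun a _ => ?_
  simp only [RCLike.star_def]
  ring

theorem krausGram_conj (r : ℝ) (φ : QubitSpace N) (k l : Fin N → Fin 2) :
    conj (krausGram r φ k l) = krausGram r φ l k := by
  rw [krausGram, krausGram, ← RCLike.star_def, Matrix.star_dotProduct, star_star]

theorem dampingChannel_pureState (r : ℝ) (φ : QubitSpace N) :
    dampingChannel N r (pureState φ) = ∑ k : Fin N → Fin 2,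
      Matrix.vecMulVec (krausTensor r k *ᵥ φ.ofLp) (star (krausTensor r k *ᵥ φ.ofLp)) := by
  refine Finset.sum_congr rfl fun k _ => ?_
  rw [pureState, ← krausTensor, Matrix.mul_vecMulVec, Matrix.vecMulVec_mul, Matrix.star_mulVec]

theorem trace_dampingChannel_pureState_sq (r : ℝ) (φ : QubitSpace N) :
    (dampingChannel N r (pureState φ) ^ 2).trace
      = ∑ k, ∑ l, krausGram r φ k l * krausGram r φ l k := by
  rw [dampingChannel_pureState, sq, Finset.sum_mul, Matrix.trace_sum]
  refine Finset.sum_congr rfl fun k _ => ?_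
  rw [Finset.mul_sum, Matrix.trace_sum]
  refine Finset.sum_congr rfl fun l _ => ?_
  rw [Matrix.vecMulVec_mul_vecMulVec, Matrix.trace_vecMulVec, dotProduct_smul, smul_eq_mul,
    dotProduct_comm _ (star _)]
  rfl

/-- The output is a sum of rank-one operators, so the trace of its square involves only their Gram
matrix, which is Hermitian. This form makes lower bounds on the purity visible. -/
theorem purity_eq_sum_normSq (r : ℝ) (φ : QubitSpace N) :
    purity (dampingChannel N r (pureState φ)) = ∑ k, ∑ l, ‖krausGram r φ k l‖ ^ 2 := by
  rw [purity, trace_dampingChannel_pureState_sq]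
  simp only [Complex.re_sum]
  refine Finset.sum_congr rfl fun k _ => Finset.sum_congr rfl fun l _ => ?_
  rw [← krausGram_conj r φ k l, Complex.mul_conj']
  norm_cast

theorem sum_comm_two_four {κ ι : Type*} [Fintype κ] [Fintype ι]
    (f : κ → κ → ι → ι → ι → ι → ℂ) :
    ∑ k, ∑ l, ∑ c, ∑ d, ∑ a, ∑ b, f k l c d a b
      = ∑ a, ∑ b, ∑ c, ∑ d, ∑ k, ∑ l, f k l c d a b := by
  have rot : ∀ f : κ → κ → ι → ℂ, ∑ k, ∑ l, ∑ c, f k l c = ∑ c, ∑ k, ∑ l, f k l c := fun f => by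
    rw [Finset.sum_congr rfl fun k _ => Finset.sum_comm, Finset.sum_comm]
  have rot' : ∀ f : ι → ι → ι → ℂ, ∑ c, ∑ d, ∑ a, f c d a = ∑ a, ∑ c, ∑ d, f c d a := fun f => by
    rw [Finset.sum_congr rfl fun k _ => Finset.sum_comm, Finset.sum_comm]
  rw [rot]
  have h : ∀ c, ∑ k, ∑ l, ∑ d, ∑ a, ∑ b, f k l c d a b
      = ∑ d, ∑ a, ∑ b, ∑ k, ∑ l, f k l c d a b := fun c => by
    rw [rot]
    refine Finset.sum_congr rfl fun d _ => ?_
    rw [rot]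
    exact Finset.sum_congr rfl fun a _ => rot _
  simp only [h]
  rw [rot']
  exact Finset.sum_congr rfl fun a _ => rot' _

/-- Expanding the Gram matrix, the sum over the Kraus labels of all qubits factorizes, leaving one
explicit kernel per site. -/
theorem purity_eq_kernel_sum {r : ℝ} (hr : r ∈ Set.Icc (0 : ℝ) 1) (φ : QubitSpace N) :
    (purity (dampingChannel N r (pureState φ)) : ℂ) = ∑ a, ∑ b, ∑ c, ∑ d,
      (kernel r a b c d : ℂ) * (φ a * φ b * conj (φ c) * conj (φ d)) := by
  have h : (purity (dampingChannel N r (pureState φ)) : ℂ)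
      = ∑ k, ∑ l, krausGram r φ k l * krausGram r φ l k := by
    rw [purity_eq_sum_normSq]
    push_cast
    refine Finset.sum_congr rfl fun k _ => Finset.sum_congr rfl fun l _ => ?_
    rw [← krausGram_conj r φ k l, Complex.mul_conj']
  have hk : ∀ a b c d : Config N, (kernel r a b c d : ℂ) = ∑ k : Fin N → Fin 2,
      ∑ l : Fin N → Fin 2, (∏ n, ((dampingKraus r (k n))ᴴ * dampingKraus r (l n)) (c n) (a n))
        * ∏ n, ((dampingKraus r (l n))ᴴ * dampingKraus r (k n)) (d n) (b n) := by
    intro a b c d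
    simp only [← Finset.prod_mul_distrib]
    have h1 : ∀ k : Fin N → Fin 2, ∑ l : Fin N → Fin 2,
        ∏ n, (((dampingKraus r (k n))ᴴ * dampingKraus r (l n)) (c n) (a n)
        * ((dampingKraus r (l n))ᴴ * dampingKraus r (k n)) (d n) (b n))
        = ∏ n, ∑ l, ((dampingKraus r (k n))ᴴ * dampingKraus r l) (c n) (a n)
        * ((dampingKraus r l)ᴴ * dampingKraus r (k n)) (d n) (b n) := fun k =>
      sum_prod_site fun n l => ((dampingKraus r (k n))ᴴ * dampingKraus r l) (c n) (a n)
        * ((dampingKraus r l)ᴴ * dampingKraus r (k n)) (d n) (b n)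
    simp only [h1]
    rw [sum_prod_site fun n k => ∑ l, ((dampingKraus r k)ᴴ * dampingKraus r l) (c n) (a n)
        * ((dampingKraus r l)ᴴ * dampingKraus r k) (d n) (b n)]
    simp only [sum_kraus_eq_siteKernel hr, kernel, Complex.ofReal_prod]
  rw [h]
  simp only [krausGram_eq_sum, Finset.sum_mul_sum]
  rw [sum_comm_two_four]
  refine Finset.sum_congr rfl fun a _ => Finset.sum_congr rfl fun b _ =>
    Finset.sum_congr rfl fun c _ => Finset.sum_congr rfl fun d _ => ?_
  rw [hk]
  simp only [Finset.sum_mul]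
  exact Finset.sum_congr rfl fun k _ => Finset.sum_congr rfl fun l _ => by ring

/-- The output purity is at least that of the maximally mixed state. -/
theorem two_pow_neg_le_purity {r : ℝ} (hr : r ∈ Set.Icc (0 : ℝ) 1) {φ : QubitSpace N}
    (hφ : ‖φ‖ = 1) : ((2 : ℝ) ^ N)⁻¹ ≤ purity (dampingChannel N r (pureState φ)) := by
  -- Completeness of the Kraus operators gives the Gram matrix unit trace; Cauchy–Schwarz over its
  -- 2^N diagonal entries then gives the bound.
  have htr : ∑ k, krausGram r φ k k = 1 := by
    simp only [krausGram_eq_sum]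
    rw [Finset.sum_comm]
    have : ∀ c a : Config N, ∑ k : Fin N → Fin 2,
        ∏ n, ((dampingKraus r (k n))ᴴ * dampingKraus r (k n)) (c n) (a n)
        = if c = a then 1 else 0 := by
      intro c a
      rw [sum_prod_site fun n k => ((dampingKraus r k)ᴴ * dampingKraus r k) (c n) (a n)]
      simp only [sum_kraus_self hr]
      rw [Finset.prod_ite_zero]
      simp [funext_iff]
    calc _ = ∑ c, conj (φ c) * φ c := by
          refine Finset.sum_congr rfl fun c _ => ?_
          rw [Finset.sum_comm]
          simp only [← Finset.mul_sum, this]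
          simp
      _ = ((‖φ‖ ^ 2 : ℝ) : ℂ) := by
          rw [EuclideanSpace.norm_sq_eq]
          push_cast
          exact Finset.sum_congr rfl fun c _ => Complex.conj_mul' _
      _ = 1 := by simp [hφ]
  rw [purity_eq_sum_normSq, inv_le_iff_one_le_mul₀ (by positivity)]
  calc (1 : ℝ) = ‖∑ k, krausGram r φ k k‖ ^ 2 := by simp [htr]
    _ ≤ (∑ k, ‖krausGram r φ k k‖) ^ 2 := by gcongr; exact norm_sum_le _ _
    _ ≤ (2 : ℝ) ^ N * ∑ k, ‖krausGram r φ k k‖ ^ 2 := by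
        simpa using sq_sum_le_card_mul_sum_sq (s := Finset.univ)
          (f := fun k : Fin N → Fin 2 => ‖krausGram r φ k k‖)
    _ ≤ (∑ k, ∑ l, ‖krausGram r φ k l‖ ^ 2) * 2 ^ N := by
        rw [mul_comm]
        gcongr with k
        exact Finset.single_le_sum (f := fun l => ‖krausGram r φ k l‖ ^ 2)
          (fun _ _ => by positivity) (Finset.mem_univ k)

end Purity

/-! ### The energy shell in the product basis. -/

section Shell

variable {N : ℕ}

/-- The number of excited qubits. -/
def excitations (s : Config N) : ℕ := (Finset.univ.filter fun n => s n = 1).card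

theorem tensor_update_excited (ω : ℝ) (n : Fin N) (s t : Config N) :
    tensor (Function.update (fun _ => 1) n ((ω : ℂ) • excited)) s t
      = if s = t then (if s n = 1 then (ω : ℂ) else 0) else 0 := by
  rw [tensor, Matrix.of_apply]
  split_ifs with h h1
  · subst h
    rw [Finset.prod_eq_single n (fun m _ hm => by simp [hm]) (by simp)]
    simp [excited, h1]
  · subst h
    refine Finset.prod_eq_zero (Finset.mem_univ n) ?_
    have : s n = 0 := by omega
    simp [excited, this]
  · obtain ⟨m, hm⟩ := Function.ne_iff.1 h
    refine Finset.prod_eq_zero (Finset.mem_univ m) ?_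
    rcases eq_or_ne m n with rfl | hmn
    · simp only [Function.update_self, Matrix.smul_apply, excited]
      generalize s m = i at hm ⊢
      generalize t m = j at hm ⊢
      fin_cases i <;> fin_cases j <;> simp_all
    · simp [hmn, hm]

theorem hamiltonian_mulVec (ω : ℝ) (v : Config N → ℂ) (s : Config N) :
    (hamiltonian N ω *ᵥ v) s = ((ω * excitations s : ℝ) : ℂ) * v s := by
  have h : ∀ t, hamiltonian N ω s t = if s = t then ((ω * excitations s : ℝ) : ℂ) else 0 := by
    intro t
    rw [hamiltonian, Matrix.sum_apply]
    simp only [tensor_update_excited]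
    split_ifs with h
    · rw [← Finset.sum_filter, Finset.sum_const, nsmul_eq_mul, excitations]
      push_cast
      ring
    · simp
  simp [Matrix.mulVec, dotProduct, h]

theorem mem_energyShell_iff {ω Δ : ℝ} (hω : 0 < ω) (hΔ : 0 < Δ) (hΔω : Δ < ω) (K : ℕ)
    (ψ : QubitSpace N) :
    ψ ∈ energyShell N ω (K * ω) Δ ↔ ∀ s, excitations s ≠ K → ψ s = 0 := by
  have hmem : ∀ (x : ℝ) (ψ : QubitSpace N),
      ψ ∈ Module.End.eigenspace (Matrix.toEuclideanLin (hamiltonian N ω)) (x : ℂ) ↔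
        ∀ s, ((ω * excitations s : ℝ) : ℂ) * ψ s = x * ψ s := by
    intro x ψ
    rw [Module.End.mem_eigenspace_iff]
    constructor
    · intro h s
      have := congrArg (fun φ : QubitSpace N => φ s) h
      simpa [Matrix.toLpLin_apply, hamiltonian_mulVec] using this
    · intro h
      ext s
      simpa [Matrix.toLpLin_apply, hamiltonian_mulVec] using h s
  constructor
  · intro h
    let T : Submodule ℂ (QubitSpace N) :=
      { carrier := {ψ | ∀ s, excitations s ≠ K → ψ s = 0}
        add_mem' := fun {a b} ha hb s hs => by simp [ha s hs, hb s hs]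
        zero_mem' := fun s _ => by simp
        smul_mem' := fun c a ha s hs => by simp [ha s hs] }
    have hle : energyShell N ω (K * ω) Δ ≤ T := by
      refine iSup₂_le fun x hx φ hφ s hs => ?_
      -- A nonzero coordinate forces the eigenvalue to be ω times its excitation number. The window
      -- is narrower than the level spacing ω, so only K fits.
      by_contra h0
      have h1 := mul_right_cancel₀ h0 ((hmem x φ).1 hφ s)
      have h2 : ω * excitations s = x := Complex.ofReal_injective h1
      rw [← h2] at hx
      refine hs (le_antisymm ?_ ?_)
      · have : (excitations s : ℝ) < K + 1 := by nlinarith [hx.2]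
        exact Nat.lt_succ_iff.1 (by exact_mod_cast this)
      · have : (K : ℝ) ≤ excitations s := by nlinarith [hx.1]
        exact_mod_cast this
    exact hle h
  · intro h
    refine Submodule.mem_iSup_of_mem (K * ω) (Submodule.mem_iSup_of_mem ?_ ?_)
    · exact ⟨le_rfl, by linarith⟩
    · rw [hmem]
      intro s
      by_cases hs : excitations s = K
      · rw [hs, mul_comm ω]
      · simp [h s hs]

/-- Configurations with `K` excited qubits. -/
abbrev ShellConfig (N K : ℕ) : Type := {s : Config N // excitations s = K}

/-- The product vectors with `K` excitations form an orthonormal basis of the shell. -/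
theorem exists_shell_basis {K : ℕ} {S : Submodule ℂ (QubitSpace N)}
    (hS : ∀ ψ, ψ ∈ S ↔ ∀ s, excitations s ≠ K → ψ s = 0) :
    ∃ b : OrthonormalBasis (ShellConfig N K) ℂ S,
      ∀ (v : S) (a : ShellConfig N K), b.repr v a = (v : QubitSpace N) a.1 := by
  let e : ShellConfig N K → S := fun a => ⟨EuclideanSpace.single a.1 1, (hS _).2 fun s hs => by
    rw [PiLp.single_apply, if_neg (fun h => hs (by rw [h]; exact a.2))]⟩
  have hon : Orthonormal ℂ e := by
    refine ⟨fun a => ?_, fun a b hab => ?_⟩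
    · rw [Submodule.coe_norm]; simp [e]
    · have hne : a.1 ≠ b.1 := fun h => hab (Subtype.ext h)
      change inner ℂ (e a) (e b) = 0
      rw [Submodule.coe_inner, EuclideanSpace.inner_single_left]
      simp [e, hne]
  have hsp : ⊤ ≤ Submodule.span ℂ (Set.range e) := by
    rintro v -
    have hv : v = ∑ a, (v : QubitSpace N) a.1 • e a := by
      ext s
      simp only [Submodule.coe_sum, Submodule.coe_smul, WithLp.ofLp_sum, Finset.sum_apply, e]
      by_cases hs : excitations s = K
      · rw [Finset.sum_eq_single ⟨s, hs⟩]
        · simp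
        · rintro ⟨t, ht⟩ - hts
          have : s ≠ t := fun h => hts (Subtype.ext h.symm)
          simp [this]
        · simp
      · rw [(hS _).1 v.2 s hs, Finset.sum_eq_zero]
        rintro ⟨t, ht⟩ -
        have : s ≠ t := fun h => hs (h ▸ ht)
        simp [this]
    rw [hv]
    exact Submodule.sum_mem _ fun a _ => Submodule.smul_mem _ _ (Submodule.subset_span ⟨a, rfl⟩)
  refine ⟨OrthonormalBasis.mk hon hsp, fun v a => ?_⟩
  rw [OrthonormalBasis.repr_apply_apply, OrthonormalBasis.coe_mk, Submodule.coe_inner]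
  simp [e, EuclideanSpace.inner_single_left]

end Shell

/-! ### First and second moments of symmetric quartic forms. -/

section QuarticForms

theorem continuous_monomial {κ ι : Type*} [Fintype κ] (x y : κ → ι) :
    Continuous (monomial x y) := by
  unfold monomial; fun_prop

variable {ι : Type*} [Fintype ι] [DecidableEq ι]
  {H : Type*} [NormedAddCommGroup H] [InnerProductSpace ℂ H]
  [CompleteSpace H] [FiniteDimensional ℂ H]

omit [DecidableEq ι] [FiniteDimensional ℂ H] in
theorem continuous_coordinates (b : OrthonormalBasis ι ℂ H) (ψ : H) :
    Continuous fun U : UnitaryGroup H => (b.repr (U.1 ψ)).ofLp := by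
  have h : Continuous fun U : UnitaryGroup H => U.1 ψ :=
    continuous_subtype_val.clm_apply continuous_const
  fun_prop

theorem integrable_haar_of_continuous {E : Type*} [NormedAddCommGroup E]
    {f : UnitaryGroup H → E} (hf : Continuous f) : Integrable f (haar H) :=
  integrableOn_univ.1 (hf.continuousOn.integrableOn_compact isCompact_univ)

theorem sum_mul_matchings {κ : Type*} [Fintype κ] [DecidableEq κ]
    (T : (κ → ι) → (κ → ι) → ℂ) :
    ∑ x, ∑ y, T x y * matchings x y = ∑ σ : Equiv.Perm κ, ∑ x, T x (x ∘ σ) := by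
  rw [Finset.sum_comm (s := (Finset.univ : Finset (Equiv.Perm κ)))]
  refine Finset.sum_congr rfl fun x _ => ?_
  simp only [matchings, Fintype.card_subtype, Finset.card_filter]
  push_cast
  simp only [Finset.mul_sum]
  rw [Finset.sum_comm]
  simp

/-- Linearity reduces this to `integral_haar_monomial`; counting matchings is then traded for
summing over the permutations themselves. -/
theorem integral_haar_sum_monomial {κ : Type*} [Fintype κ] [DecidableEq κ]
    (b : OrthonormalBasis ι ℂ H) {ψ : H} (hψ : ‖ψ‖ = 1) (T : (κ → ι) → (κ → ι) → ℂ) :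
    (∑ t : κ → ι, (matchings t t : ℂ)) * ∫ U : UnitaryGroup H,
      ∑ x, ∑ y, T x y * monomial x y (b.repr (U.1 ψ)) ∂(haar H)
      = ∑ σ : Equiv.Perm κ, ∑ x, T x (x ∘ σ) := by
  have hint : ∀ x y, Integrable (fun U : UnitaryGroup H =>
      T x y * monomial x y (b.repr (U.1 ψ))) (haar H) := fun x y =>
    integrable_haar_of_continuous (continuous_const.mul
      ((continuous_monomial x y).comp (continuous_coordinates b ψ)))
  rw [integral_finsetSum _ fun x _ => integrable_finsetSum _ fun y _ => hint x y,
    ← sum_mul_matchings, Finset.mul_sum]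
  refine Finset.sum_congr rfl fun x _ => ?_
  rw [integral_finsetSum _ fun y _ => hint x y, Finset.mul_sum]
  refine Finset.sum_congr rfl fun y _ => ?_
  rw [integral_const_mul, ← integral_haar_monomial b hψ x y]
  ring

omit [DecidableEq ι] in
theorem sum_fin_two_arrow {M : Type*} [AddCommMonoid M] (f : (Fin 2 → ι) → M) :
    ∑ x, f x = ∑ a, ∑ b, f ![a, b] := by
  rw [← Fintype.sum_prod_type']
  exact Fintype.sum_equiv (finTwoArrowEquiv ι) _ _ fun x => by
    congr 1; ext i; fin_cases i <;> rfl

omit [DecidableEq ι] in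
theorem sum_fin_four_arrow {M : Type*} [AddCommMonoid M] (f : (Fin 4 → ι) → M) :
    ∑ x, f x = ∑ x : Fin 2 → ι, ∑ y : Fin 2 → ι, f (Fin.append x y) := by
  rw [← Fintype.sum_prod_type']
  exact (Fintype.sum_equiv (Fin.appendEquiv 2 2) _ _ fun x => rfl).symm

omit [DecidableEq ι] in
theorem sum_fin_four_arrow' {M : Type*} [AddCommMonoid M] (f : (Fin 4 → ι) → M) :
    ∑ x, f x = ∑ a, ∑ b, ∑ c, ∑ d, f ![a, b, c, d] := by
  rw [sum_fin_four_arrow]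
  simp only [sum_fin_two_arrow]
  refine Finset.sum_congr rfl fun a _ => Finset.sum_congr rfl fun b _ =>
    Finset.sum_congr rfl fun c _ => Finset.sum_congr rfl fun d _ => ?_
  congr 1
  ext i
  fin_cases i <;> rfl

/-- The quartic form with coefficients `S`, as a function of the coordinates. -/
noncomputable def quarticForm (S : ι → ι → ι → ι → ℝ) (z : ι → ℂ) : ℂ :=
  ∑ x : Fin 2 → ι, ∑ y : Fin 2 → ι, (S (x 0) (x 1) (y 0) (y 1) : ℂ) * monomial x y z

omit [DecidableEq ι] in
theorem quarticForm_sq (S : ι → ι → ι → ι → ℝ) (z : ι → ℂ) :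
    quarticForm S z ^ 2 = ∑ x : Fin 4 → ι, ∑ y : Fin 4 → ι,
      ((S (x 0) (x 1) (y 0) (y 1) * S (x 2) (x 3) (y 2) (y 3) : ℝ) : ℂ) * monomial x y z := by
  rw [sum_fin_four_arrow]
  simp only [sum_fin_four_arrow]
  rw [sq, quarticForm, Finset.sum_mul_sum]
  refine Finset.sum_congr rfl fun x _ => Finset.sum_congr rfl fun x' _ => ?_
  rw [Finset.sum_mul_sum]
  refine Finset.sum_congr rfl fun y _ => Finset.sum_congr rfl fun y' _ => ?_
  have e : ∀ u v : Fin 2 → ι, (Fin.append u v : Fin 4 → ι) 0 = u 0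
      ∧ (Fin.append u v : Fin 4 → ι) 1 = u 1 ∧ (Fin.append u v : Fin 4 → ι) 2 = v 0
      ∧ (Fin.append u v : Fin 4 → ι) 3 = v 1 := fun u v => ⟨rfl, rfl, rfl, rfl⟩
  obtain ⟨hx0, hx1, hx2, hx3⟩ := e x x'
  obtain ⟨hy0, hy1, hy2, hy3⟩ := e y y'
  rw [monomial, monomial, monomial, Fin.prod_univ_two, Fin.prod_univ_two]
  erw [Fin.prod_univ_four]
  rw [hx0, hx1, hx2, hx3, hy0, hy1, hy2, hy3]
  push_cast
  ring

/-- The sum `∑ S(x₀ x₁; x_i x_j) S(x₂ x₃; x_k x_l)`. -/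
def quarticPairing (S : ι → ι → ι → ι → ℝ) (i j k l : Fin 4) : ℝ :=
  ∑ x : Fin 4 → ι, S (x 0) (x 1) (x i) (x j) * S (x 2) (x 3) (x k) (x l)

/-- The classification of the permutations of four points relative to the pairs `01|23`. -/
theorem perm_fin_four_cases (σ : Equiv.Perm (Fin 4)) :
    ((σ 0 < 2 ∧ σ 1 < 2) ∧ (((σ 0 = 0 ∧ σ 1 = 1) ∨ (σ 0 = 1 ∧ σ 1 = 0))
      ∧ ((σ 2 = 2 ∧ σ 3 = 3) ∨ (σ 2 = 3 ∧ σ 3 = 2)))) ∨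
    (¬(σ 0 < 2 ∧ σ 1 < 2) ∧ (2 ≤ σ 0 ∧ 2 ≤ σ 1) ∧ (((σ 0 = 2 ∧ σ 1 = 3) ∨ (σ 0 = 3 ∧ σ 1 = 2))
      ∧ ((σ 2 = 0 ∧ σ 3 = 1) ∨ (σ 2 = 1 ∧ σ 3 = 0)))) ∨
    (¬(σ 0 < 2 ∧ σ 1 < 2) ∧ ¬(2 ≤ σ 0 ∧ 2 ≤ σ 1) ∧
      ((((σ 0 = 0 ∧ σ 1 = 2) ∨ (σ 0 = 2 ∧ σ 1 = 0))
        ∧ ((σ 2 = 1 ∧ σ 3 = 3) ∨ (σ 2 = 3 ∧ σ 3 = 1))) ∨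
      (((σ 0 = 0 ∧ σ 1 = 3) ∨ (σ 0 = 3 ∧ σ 1 = 0))
        ∧ ((σ 2 = 1 ∧ σ 3 = 2) ∨ (σ 2 = 2 ∧ σ 3 = 1))) ∨
      (((σ 0 = 1 ∧ σ 1 = 2) ∨ (σ 0 = 2 ∧ σ 1 = 1))
        ∧ ((σ 2 = 0 ∧ σ 3 = 3) ∨ (σ 2 = 3 ∧ σ 3 = 0))) ∨
      (((σ 0 = 1 ∧ σ 1 = 3) ∨ (σ 0 = 3 ∧ σ 1 = 1))
        ∧ ((σ 2 = 0 ∧ σ 3 = 2) ∨ (σ 2 = 2 ∧ σ 3 = 0))))) := by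
  revert σ
  decide

/-- The trace of the form, on the diagonal of pairs. -/
def pairTrace (S : ι → ι → ι → ι → ℝ) : ℝ := ∑ a, ∑ b, S a b a b

/-- The partial trace of the form over one of the two copies. -/
def partialTrace (S : ι → ι → ι → ι → ℝ) (q u : ι) : ℝ := ∑ p, S p q p u

variable {S : ι → ι → ι → ι → ℝ}

omit [DecidableEq ι] in
theorem quarticPairing_swap_left (h2 : ∀ a b c d, S a b d c = S a b c d) (i j k l : Fin 4) :
    quarticPairing S j i k l = quarticPairing S i j k l :=
  Finset.sum_congr rfl fun x _ => by rw [h2]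

omit [DecidableEq ι] in
theorem quarticPairing_swap_right (h2 : ∀ a b c d, S a b d c = S a b c d) (i j k l : Fin 4) :
    quarticPairing S i j l k = quarticPairing S i j k l :=
  Finset.sum_congr rfl fun x _ => by rw [h2 (x 2)]

omit [DecidableEq ι] in
theorem quarticPairing_parallel : quarticPairing S 0 1 2 3 = pairTrace S ^ 2 := by
  simp only [quarticPairing, sum_fin_four_arrow', sq, pairTrace, Finset.sum_mul, Finset.mul_sum]
  refine Finset.sum_congr rfl fun a _ => Finset.sum_congr rfl fun b _ =>
    Finset.sum_congr rfl fun c _ => Finset.sum_congr rfl fun d _ => mul_comm _ _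

omit [DecidableEq ι] in
theorem quarticPairing_crossed :
    quarticPairing S 2 3 0 1 = ∑ a, ∑ b, ∑ c, ∑ d, S a b c d * S c d a b := by
  simp only [quarticPairing, sum_fin_four_arrow']
  rfl

-- When each output pair takes one index from either copy, the sum closes up into the trace of the
-- squared partial trace. The symmetries within pairs reduce all four patterns to one.
omit [DecidableEq ι] in
theorem quarticPairing_mixed (h1 : ∀ a b c d, S b a c d = S a b c d)
    (h2 : ∀ a b c d, S a b d c = S a b c d) :
    quarticPairing S 0 2 1 3 = ∑ q, ∑ u, partialTrace S q u * partialTrace S u q ∧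
    quarticPairing S 0 3 1 2 = ∑ q, ∑ u, partialTrace S q u * partialTrace S u q ∧
    quarticPairing S 1 2 0 3 = ∑ q, ∑ u, partialTrace S q u * partialTrace S u q ∧
    quarticPairing S 1 3 0 2 = ∑ q, ∑ u, partialTrace S q u * partialTrace S u q := by
  have base : ∑ q, ∑ u, partialTrace S q u * partialTrace S u q
      = ∑ q, ∑ p, ∑ u, ∑ w, S p q p u * S w u w q := by
    refine Finset.sum_congr rfl fun q _ => ?_
    rw [Finset.sum_comm]
    refine Finset.sum_congr rfl fun u _ => ?_
    rw [partialTrace, partialTrace, Finset.sum_mul_sum]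
  have flip : ∀ a b c d, S b a d c = S a b c d := fun a b c d => by rw [h1, h2]
  refine ⟨?_, ?_, ?_, ?_⟩
  · rw [base, Finset.sum_comm]
    simp only [quarticPairing, sum_fin_four_arrow']
    refine Finset.sum_congr rfl fun p _ => Finset.sum_congr rfl fun q _ =>
      Finset.sum_congr rfl fun u _ => Finset.sum_congr rfl fun w _ => ?_
    change S p q p u * S u w q w = _
    rw [← flip u w q w]
  · rw [base, Finset.sum_comm]
    simp only [quarticPairing, sum_fin_four_arrow']
    refine Finset.sum_congr rfl fun p _ => Finset.sum_congr rfl fun q _ => ?_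
    rw [Finset.sum_comm]
    refine Finset.sum_congr rfl fun u _ => Finset.sum_congr rfl fun w _ => ?_
    change S p q p u * S w u q w = _
    rw [h2 w u w q]
  · rw [base]
    simp only [quarticPairing, sum_fin_four_arrow']
    refine Finset.sum_congr rfl fun p _ => Finset.sum_congr rfl fun q _ =>
      Finset.sum_congr rfl fun u _ => Finset.sum_congr rfl fun w _ => ?_
    change S p q q u * S u w p w = _
    rw [h1 q p, ← flip u w p w]
  · rw [base]
    simp only [quarticPairing, sum_fin_four_arrow']
    refine Finset.sum_congr rfl fun p _ => Finset.sum_congr rfl fun q _ => ?_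
    rw [Finset.sum_comm]
    refine Finset.sum_congr rfl fun u _ => Finset.sum_congr rfl fun w _ => ?_
    change S p q q u * S w u p w = _
    rw [h1 q p, h2 w u w p]

omit [DecidableEq ι] in
theorem sum_quarticPairing (h1 : ∀ a b c d, S b a c d = S a b c d)
    (h2 : ∀ a b c d, S a b d c = S a b c d) :
    ∑ σ : Equiv.Perm (Fin 4), quarticPairing S (σ 0) (σ 1) (σ 2) (σ 3)
      = 4 * pairTrace S ^ 2 + 4 * (∑ a, ∑ b, ∑ c, ∑ d, S a b c d * S c d a b)
        + 16 * ∑ q, ∑ u, partialTrace S q u * partialTrace S u q := by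
  obtain ⟨m1, m2, m3, m4⟩ := quarticPairing_mixed h1 h2
  have hL := quarticPairing_swap_left h2
  have hR := quarticPairing_swap_right h2
  have key : ∀ σ : Equiv.Perm (Fin 4), quarticPairing S (σ 0) (σ 1) (σ 2) (σ 3)
      = if σ 0 < 2 ∧ σ 1 < 2 then pairTrace S ^ 2 else if 2 ≤ σ 0 ∧ 2 ≤ σ 1 then
        ∑ a, ∑ b, ∑ c, ∑ d, S a b c d * S c d a b else
        ∑ q, ∑ u, partialTrace S q u * partialTrace S u q := by
    intro σ
    rcases perm_fin_four_cases σ with ⟨h, h01, h23⟩ | ⟨h, h', h01, h23⟩ | ⟨h, h', h4⟩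
    · rw [if_pos h, ← quarticPairing_parallel]
      rcases h01 with ⟨e0, e1⟩ | ⟨e0, e1⟩ <;> rcases h23 with ⟨e2, e3⟩ | ⟨e2, e3⟩ <;>
        rw [e0, e1, e2, e3] <;> simp only [hL 0 1, hR _ _ 2 3]
    · rw [if_neg h, if_pos h', ← quarticPairing_crossed]
      rcases h01 with ⟨e0, e1⟩ | ⟨e0, e1⟩ <;> rcases h23 with ⟨e2, e3⟩ | ⟨e2, e3⟩ <;>
        rw [e0, e1, e2, e3] <;> simp only [hL 2 3, hR _ _ 0 1]
    · rw [if_neg h, if_neg h']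
      rcases h4 with ⟨h01, h23⟩ | ⟨h01, h23⟩ | ⟨h01, h23⟩ | ⟨h01, h23⟩
      · rw [← m1]
        rcases h01 with ⟨e0, e1⟩ | ⟨e0, e1⟩ <;> rcases h23 with ⟨e2, e3⟩ | ⟨e2, e3⟩ <;>
          rw [e0, e1, e2, e3] <;> simp only [hL 0 2, hR _ _ 1 3]
      · rw [← m2]
        rcases h01 with ⟨e0, e1⟩ | ⟨e0, e1⟩ <;> rcases h23 with ⟨e2, e3⟩ | ⟨e2, e3⟩ <;>
          rw [e0, e1, e2, e3] <;> simp only [hL 0 3, hR _ _ 1 2]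
      · rw [← m3]
        rcases h01 with ⟨e0, e1⟩ | ⟨e0, e1⟩ <;> rcases h23 with ⟨e2, e3⟩ | ⟨e2, e3⟩ <;>
          rw [e0, e1, e2, e3] <;> simp only [hL 1 2, hR _ _ 0 3]
      · rw [← m4]
        rcases h01 with ⟨e0, e1⟩ | ⟨e0, e1⟩ <;> rcases h23 with ⟨e2, e3⟩ | ⟨e2, e3⟩ <;>
          rw [e0, e1, e2, e3] <;> simp only [hL 1 3, hR _ _ 0 2]
  simp only [key]
  rw [Finset.sum_ite, Finset.sum_ite, Finset.sum_const, Finset.sum_const, Finset.sum_const,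
    show (Finset.univ.filter fun σ : Equiv.Perm (Fin 4) => σ 0 < 2 ∧ σ 1 < 2).card = 4 by decide,
    show ((Finset.univ.filter fun σ : Equiv.Perm (Fin 4) => ¬(σ 0 < 2 ∧ σ 1 < 2)).filter
      fun σ => 2 ≤ σ 0 ∧ 2 ≤ σ 1).card = 4 by decide,
    show ((Finset.univ.filter fun σ : Equiv.Perm (Fin 4) => ¬(σ 0 < 2 ∧ σ 1 < 2)).filter
      fun σ => ¬(2 ≤ σ 0 ∧ 2 ≤ σ 1)).card = 16 by decide]
  simp only [nsmul_eq_mul]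
  push_cast
  ring

/-- The identity fixes every pair, the transposition only the pairs with equal entries. -/
theorem sum_matchings_two :
    ∑ t : Fin 2 → ι, (matchings t t : ℂ)
      = (Fintype.card ι : ℂ) ^ 2 + Fintype.card ι := by
  have h : ∀ t : Fin 2 → ι, (matchings t t : ℂ) = 1 + if t 0 = t 1 then 1 else 0 := by
    intro t
    simp only [matchings, Fintype.card_subtype, Finset.card_filter]
    push_cast
    rw [show (Finset.univ : Finset (Equiv.Perm (Fin 2))) = {1, Equiv.swap 0 1} by decide,
      Finset.sum_pair (by decide)]
    congr 1
    · simp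
    · refine if_congr ⟨fun h => ?_, fun h => ?_⟩ rfl rfl
      · simpa using (congrFun h 1)
      · ext i; fin_cases i <;> simp [h]
  simp only [h, sum_fin_two_arrow]
  simp [Finset.sum_add_distrib, sq]

omit [Fintype ι] in
theorem one_le_matchings_self {κ : Type*} [Fintype κ] [DecidableEq κ] (t : κ → ι) :
    1 ≤ matchings t t :=
  Fintype.card_pos_iff.2 ⟨⟨1, rfl⟩⟩

variable (b : OrthonormalBasis ι ℂ H) {ψ : H} (hψ : ‖ψ‖ = 1) {X : UnitaryGroup H → ℝ}
  (hX : ∀ U, (X U : ℂ) = quarticForm S (b.repr (U.1 ψ)))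

include hψ hX in
/-- The mean of a symmetric quartic form. -/
theorem integral_quarticForm (h2 : ∀ a b c d, S a b d c = S a b c d) :
    ((Fintype.card ι : ℝ) ^ 2 + Fintype.card ι) * ∫ U, X U ∂(haar H) = 2 * pairTrace S := by
  have h := integral_haar_sum_monomial b hψ (κ := Fin 2)
    fun x y => (S (x 0) (x 1) (y 0) (y 1) : ℂ)
  rw [sum_matchings_two] at h
  have hI : ∫ U : UnitaryGroup H, ∑ x : Fin 2 → ι, ∑ y : Fin 2 → ι,
      (S (x 0) (x 1) (y 0) (y 1) : ℂ) * monomial x y (b.repr (U.1 ψ)) ∂(haar H)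
      = ((∫ U, X U ∂(haar H) : ℝ) : ℂ) := by
    rw [← integral_complex_ofReal]
    exact integral_congr_ae (Filter.Eventually.of_forall fun U => (hX U).symm)
  rw [hI, show (Finset.univ : Finset (Equiv.Perm (Fin 2))) = {1, Equiv.swap 0 1} by decide,
      Finset.sum_pair (by decide)] at h
  simp only [sum_fin_two_arrow, Function.comp_apply, Equiv.Perm.coe_one, id, Equiv.swap_apply_left,
    Equiv.swap_apply_right, Matrix.cons_val_zero, Matrix.cons_val_one, h2] at h
  rw [two_mul, pairTrace]
  exact_mod_cast h

include hψ hX in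
/-- The second moment of a nonnegative symmetric quartic form. -/
theorem integral_quarticForm_sq_le (h1 : ∀ a b c d, S b a c d = S a b c d)
    (h2 : ∀ a b c d, S a b d c = S a b c d) :
    (Fintype.card ι : ℝ) ^ 4 * ∫ U, X U ^ 2 ∂(haar H)
      ≤ 4 * pairTrace S ^ 2 + 4 * (∑ a, ∑ b, ∑ c, ∑ d, S a b c d * S c d a b)
        + 16 * ∑ q, ∑ u, partialTrace S q u * partialTrace S u q := by
  have h := integral_haar_sum_monomial b hψ (κ := Fin 4)
    fun x y => ((S (x 0) (x 1) (y 0) (y 1) * S (x 2) (x 3) (y 2) (y 3) : ℝ) : ℂ)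
  have hI : ∫ U : UnitaryGroup H, ∑ x : Fin 4 → ι, ∑ y : Fin 4 → ι,
      ((S (x 0) (x 1) (y 0) (y 1) * S (x 2) (x 3) (y 2) (y 3) : ℝ) : ℂ)
        * monomial x y (b.repr (U.1 ψ)) ∂(haar H)
      = ((∫ U, X U ^ 2 ∂(haar H) : ℝ) : ℂ) := by
    rw [← integral_complex_ofReal]
    refine integral_congr_ae (Filter.Eventually.of_forall fun U => ?_)
    simp only
    rw [← quarticForm_sq, ← hX, Complex.ofReal_pow]
  rw [hI] at h
  have h' : (∑ t : Fin 4 → ι, (matchings t t : ℝ)) * ∫ U, X U ^ 2 ∂(haar H)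
      = ∑ σ : Equiv.Perm (Fin 4), quarticPairing S (σ 0) (σ 1) (σ 2) (σ 3) := by
    simp only [quarticPairing]
    exact_mod_cast h
  rw [← sum_quarticPairing h1 h2, ← h']
  -- The exact normalisation is replaced by d⁴, since each of the d⁴ tuples has at least the
  -- identity matching; the squared integrand makes this an upper bound.
  refine mul_le_mul_of_nonneg_right ?_ (integral_nonneg fun U => sq_nonneg _)
  calc (Fintype.card ι : ℝ) ^ 4 = ∑ t : Fin 4 → ι, (1 : ℝ) := by simp
    _ ≤ _ := Finset.sum_le_sum fun t _ => by exact_mod_cast one_le_matchings_self t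

end QuarticForms

/-! ### Identities and bounds for the site kernel and its products. -/

section Kernel

/-- The single-qubit purity of the output for an excited input. -/
def excitedPurity (r : ℝ) : ℝ := (1 - r) ^ 2 + r ^ 2

theorem excitedPurity_pos (r : ℝ) : 0 < excitedPurity r := by
  unfold excitedPurity; nlinarith [sq_nonneg (1 - 2 * r)]

theorem siteKernel_swap (r : ℝ) (a b c d : Fin 2) :
    siteKernel r b a d c = siteKernel r a b c d := by
  fin_cases a <;> fin_cases b <;> fin_cases c <;> fin_cases d <;> simp [siteKernel]

theorem siteKernel_symm (r : ℝ) (a b c d : Fin 2) :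
    siteKernel r c d a b = siteKernel r a b c d := by
  fin_cases a <;> fin_cases b <;> fin_cases c <;> fin_cases d <;> simp [siteKernel]

theorem siteKernel_eq_zero (r : ℝ) {q u : Fin 2} (h : q ≠ u) (p : Fin 2) :
    siteKernel r p q p u = 0 ∧ siteKernel r p q u p = 0 := by
  fin_cases p <;> fin_cases q <;> fin_cases u <;> simp_all [siteKernel]

theorem siteKernel_nonneg {r : ℝ} (hr : r ∈ Set.Icc (0 : ℝ) 1) (a b c d : Fin 2) :
    0 ≤ siteKernel r a b c d := by
  have h0 := hr.1
  have h1 : 0 ≤ 1 - r := by linarith [hr.2]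
  unfold siteKernel
  split_ifs <;> positivity

theorem siteKernel_le_one {r : ℝ} (hr : r ∈ Set.Icc (0 : ℝ) 1) (a b c d : Fin 2) :
    siteKernel r a b c d ≤ 1 := by
  obtain ⟨h0, h1⟩ := hr
  unfold siteKernel
  split_ifs <;> nlinarith

/-- An excited input contributes one factor of its output purity, whether the other copy is excited
or not. Hence full row sums of squares depend on excitation numbers alone. -/
theorem sum_siteKernel_sq (r : ℝ) (a b : Fin 2) :
    ∑ c, ∑ d, siteKernel r a b c d ^ 2
      = (if a = 1 then excitedPurity r else 1) * (if b = 1 then excitedPurity r else 1) := by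
  simp only [Fin.sum_univ_two]
  fin_cases a <;> fin_cases b <;> simp [siteKernel, excitedPurity] <;> ring

variable {N : ℕ}

theorem kernel_swap (r : ℝ) (a b c d : Config N) : kernel r b a d c = kernel r a b c d :=
  Finset.prod_congr rfl fun _ _ => siteKernel_swap r _ _ _ _

theorem kernel_symm (r : ℝ) (a b c d : Config N) : kernel r c d a b = kernel r a b c d :=
  Finset.prod_congr rfl fun _ _ => siteKernel_symm r _ _ _ _

theorem kernel_eq_zero (r : ℝ) {q u : Config N} (h : q ≠ u) (p : Config N) :
    kernel r p q p u = 0 ∧ kernel r p q u p = 0 := by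
  obtain ⟨n, hn⟩ := Function.ne_iff.1 h
  exact ⟨Finset.prod_eq_zero (Finset.mem_univ n) (siteKernel_eq_zero r hn _).1,
    Finset.prod_eq_zero (Finset.mem_univ n) (siteKernel_eq_zero r hn _).2⟩

theorem kernel_nonneg {r : ℝ} (hr : r ∈ Set.Icc (0 : ℝ) 1) (a b c d : Config N) :
    0 ≤ kernel r a b c d :=
  Finset.prod_nonneg fun _ _ => siteKernel_nonneg hr _ _ _ _

theorem kernel_le_one {r : ℝ} (hr : r ∈ Set.Icc (0 : ℝ) 1) (a b c d : Config N) :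
    kernel r a b c d ≤ 1 :=
  Finset.prod_le_one (fun _ _ => siteKernel_nonneg hr _ _ _ _)
    fun _ _ => siteKernel_le_one hr _ _ _ _

theorem kernel_comp_perm (r : ℝ) (σ : Equiv.Perm (Fin N)) (a b c d : Config N) :
    kernel r (a ∘ σ) (b ∘ σ) (c ∘ σ) (d ∘ σ) = kernel r a b c d :=
  Equiv.prod_comp σ fun n => siteKernel r (a n) (b n) (c n) (d n)

theorem prod_excited (s : Config N) (h : ℝ) :
    ∏ n, (if s n = 1 then h else 1) = h ^ excitations s := by
  rw [Finset.prod_ite, Finset.prod_const, Finset.prod_const_one, mul_one, excitations]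

theorem sum_kernel_sq (r : ℝ) (a b : Config N) :
    ∑ c, ∑ d, kernel r a b c d ^ 2
      = excitedPurity r ^ excitations a * excitedPurity r ^ excitations b := by
  simp only [kernel, ← Finset.prod_pow]
  have h1 : ∀ c : Config N, ∑ d : Config N, ∏ n, siteKernel r (a n) (b n) (c n) (d n) ^ 2
      = ∏ n, ∑ d, siteKernel r (a n) (b n) (c n) d ^ 2 := fun c =>
    sum_prod_site fun n d => siteKernel r (a n) (b n) (c n) d ^ 2
  simp only [h1]
  rw [sum_prod_site fun n c => ∑ d, siteKernel r (a n) (b n) c d ^ 2]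
  simp only [sum_siteKernel_sq, Finset.prod_mul_distrib, prod_excited]

theorem excitations_add_card_ground (s : Config N) :
    excitations s + (Finset.univ.filter fun n => s n = 0).card = N := by
  have h := Finset.card_filter_add_card_filter_not (s := (Finset.univ : Finset (Fin N)))
    (fun n => s n = 1)
  have h2 : (Finset.univ.filter fun n => ¬ s n = 1) = Finset.univ.filter fun n => s n = 0 := by
    ext n
    simp only [Finset.mem_filter, Finset.mem_univ, true_and]
    omega
  rw [h2] at h
  simpa [excitations] using h

/-- At a disagreement one configuration is excited and the other is in the ground state, so the
disagreements can be counted through either kind of site. -/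
theorem card_ne_le {K : ℕ} {a b : Config N} (ha : excitations a = K) (hb : excitations b = K) :
    (Finset.univ.filter fun n => a n ≠ b n).card ≤ 2 * min K (N - K) := by
  have h1 : (Finset.univ.filter fun n => a n ≠ b n).card ≤ excitations a + excitations b := by
    refine (Finset.card_le_card (fun n hn => ?_)).trans (Finset.card_union_le _ _)
    simp only [Finset.mem_filter, Finset.mem_univ, true_and, Finset.mem_union] at hn ⊢
    omega
  have h2 : (Finset.univ.filter fun n => a n ≠ b n).card
      ≤ (Finset.univ.filter fun n => a n = 0).card
        + (Finset.univ.filter fun n => b n = 0).card := by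
    refine (Finset.card_le_card (fun n hn => ?_)).trans (Finset.card_union_le _ _)
    simp only [Finset.mem_filter, Finset.mem_univ, true_and, Finset.mem_union] at hn ⊢
    omega
  have h3 := excitations_add_card_ground a
  have h4 := excitations_add_card_ground b
  omega

/-- The diagonal and exchange kernels together dominate a multiple of the product of purities. -/
theorem le_kernel_add_kernel {r : ℝ} (hr : r ∈ Set.Icc (0 : ℝ) 1) {K : ℕ} {a b : Config N}
    (ha : excitations a = K) (hb : excitations b = K) :
    excitedPurity r ^ K / 2 ^ min K (N - K) ≤ kernel r a b a b + kernel r a b b a := by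
  set g := excitedPurity r with hg
  have hg0 := excitedPurity_pos r
  set h := Real.sqrt g
  set s := Real.sqrt (1 / 2)
  have hh : h * h = g := Real.mul_self_sqrt hg0.le
  have hs : s * s = 1 / 2 := Real.mul_self_sqrt (by norm_num)
  have hh0 : 0 ≤ h := Real.sqrt_nonneg _
  have hs0 : 0 ≤ s := Real.sqrt_nonneg _
  have hs1 : s ≤ 1 := by nlinarith
  -- Each excitation carries √g, with g here the single-qubit purity, and each disagreement costs
  -- √(1/2). There are at most 2 min(K, N-K) disagreements, whence the power of two.
  have hlow : g ^ K / 2 ^ min K (N - K) ≤ ∏ n, ((if a n = 1 then h else 1)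
      * (if b n = 1 then h else 1) * (if a n ≠ b n then s else 1)) := by
    rw [Finset.prod_mul_distrib, Finset.prod_mul_distrib, prod_excited, prod_excited, ha, hb,
      ← mul_pow, hh, Finset.prod_ite, Finset.prod_const, Finset.prod_const_one, mul_one,
      div_eq_mul_inv]
    refine mul_le_mul_of_nonneg_left ?_ (by positivity)
    calc ((2 : ℝ) ^ min K (N - K))⁻¹ = s ^ (2 * min K (N - K)) := by
          rw [pow_mul, sq, hs, one_div, inv_pow]
      _ ≤ _ := pow_le_pow_of_le_one hs0 hs1 (card_ne_le ha hb)
  have hx : ∀ x : ℝ, 0 ≤ x → g / 2 ≤ x ^ 2 → h * s ≤ x := fun x hx hx2 => by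
    refine abs_le_of_sq_le_sq' ?_ hx |>.2
    calc (h * s) ^ 2 = (h * h) * (s * s) := by ring
      _ = g / 2 := by rw [hh, hs]; ring
      _ ≤ x ^ 2 := hx2
  have hfac : ∀ i j : Fin 2, 0 ≤ (if i = 1 then h else 1) * (if j = 1 then h else 1)
      * (if i ≠ j then s else 1) := fun i j => by
    split_ifs <;> positivity
  -- At a disagreement the diagonal kernel gives 1-r and the exchange kernel r. The larger of the
  -- two squares is at least their average g/2, so one kernel alone suffices at every site.
  rcases le_total r (1 - r) with hle | hle
  · have h1 : h * s ≤ 1 - r := hx _ (by linarith [hr.2]) (by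
      rw [hg, excitedPurity]; nlinarith [hr.1])
    refine (hlow.trans (Finset.prod_le_prod (fun n _ => hfac _ _) fun n _ => ?_)).trans
      (le_add_of_nonneg_right (kernel_nonneg hr _ _ _ _))
    generalize a n = i
    generalize b n = j
    fin_cases i <;> fin_cases j <;> simp [siteKernel, hh, h1]
    exact hg.le
  · have h1 : h * s ≤ r := hx _ hr.1 (by
      rw [hg, excitedPurity]; nlinarith [hr.2])
    refine (hlow.trans (Finset.prod_le_prod (fun n _ => hfac _ _) fun n _ => ?_)).trans
      (le_add_of_nonneg_left (kernel_nonneg hr _ _ _ _))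
    generalize a n = i
    generalize b n = j
    fin_cases i <;> fin_cases j <;> simp [siteKernel, hh, h1]
    exact hg.le

end Kernel

/-! ### The symmetrized kernel on the shell and its dimension. -/

section ShellKernel

variable {N K : ℕ}

/-- The kernel of `Tr ρ_A²` on the shell, symmetrized in the two copies. -/
noncomputable def shellKernel (N K : ℕ) (r : ℝ) (a b c d : ShellConfig N K) : ℝ :=
  (kernel r a.1 b.1 c.1 d.1 + kernel r a.1 b.1 d.1 c.1) / 2

theorem shellKernel_swap_right (r : ℝ) (a b c d : ShellConfig N K) :
    shellKernel N K r a b d c = shellKernel N K r a b c d := by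
  unfold shellKernel; ring

theorem shellKernel_swap_left (r : ℝ) (a b c d : ShellConfig N K) :
    shellKernel N K r b a c d = shellKernel N K r a b c d := by
  unfold shellKernel
  rw [kernel_swap r a.1 b.1 d.1 c.1, kernel_swap r a.1 b.1 c.1 d.1]
  ring

theorem shellKernel_symm (r : ℝ) (a b c d : ShellConfig N K) :
    shellKernel N K r c d a b = shellKernel N K r a b c d := by
  unfold shellKernel
  rw [kernel_symm r a.1 b.1 c.1 d.1, kernel_symm r b.1 a.1 c.1 d.1, kernel_swap r a.1 b.1 d.1 c.1]

theorem sum_shellConfig {M : Type*} [AddCommMonoid M] (f : Config N → M) :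
    ∑ a : ShellConfig N K, f a.1 = ∑ s with excitations s = K, f s :=
  (Finset.sum_subtype _ (by simp) f).symm

/-- Symmetrizing does not increase the sum of squares, and dropping the shell constraint on the last
two indices only adds nonnegative terms; the unconstrained sum then factorizes over sites. -/
theorem sum_shellKernel_sq_le (r : ℝ) :
    ∑ a, ∑ b, ∑ c, ∑ d, shellKernel N K r a b c d * shellKernel N K r c d a b
      ≤ (Fintype.card (ShellConfig N K) : ℝ) ^ 2 * (excitedPurity r ^ K) ^ 2 := by
  have hsub : ∀ f : Config N → ℝ, (∀ s, 0 ≤ f s) →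
      ∑ c : ShellConfig N K, f c.1 ≤ ∑ c, f c := fun f hf => by
    rw [sum_shellConfig]
    exact Finset.sum_le_univ_sum_of_nonneg hf
  have hab : ∀ a b : ShellConfig N K,
      ∑ c, ∑ d, shellKernel N K r a b c d * shellKernel N K r c d a b
        ≤ (excitedPurity r ^ K) ^ 2 := by
    intro a b
    have hk : ∑ c : ShellConfig N K, ∑ d : ShellConfig N K, kernel r a.1 b.1 c.1 d.1 ^ 2
        ≤ (excitedPurity r ^ K) ^ 2 := by
      have := sum_kernel_sq r a.1 b.1
      rw [a.2, b.2, ← sq] at this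
      rw [← this]
      refine (Finset.sum_le_sum fun c _ => hsub (fun d => kernel r a.1 b.1 c.1 d ^ 2)
        fun _ => sq_nonneg _).trans ?_
      exact hsub (fun c => ∑ d, kernel r a.1 b.1 c d ^ 2)
        fun _ => Finset.sum_nonneg fun _ _ => sq_nonneg _
    calc _ ≤ ∑ c : ShellConfig N K, ∑ d : ShellConfig N K,
          (kernel r a.1 b.1 c.1 d.1 ^ 2 + kernel r a.1 b.1 d.1 c.1 ^ 2) / 2 := by
          refine Finset.sum_le_sum fun c _ => Finset.sum_le_sum fun d _ => ?_
          rw [shellKernel_symm r a b c d, shellKernel]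
          nlinarith [sq_nonneg (kernel r a.1 b.1 c.1 d.1 - kernel r a.1 b.1 d.1 c.1)]
      _ = ∑ c : ShellConfig N K, ∑ d : ShellConfig N K, kernel r a.1 b.1 c.1 d.1 ^ 2 := by
          simp only [← Finset.sum_div, Finset.sum_add_distrib]
          rw [Finset.sum_comm (f := fun c d : ShellConfig N K => kernel r a.1 b.1 d.1 c.1 ^ 2)]
          ring
      _ ≤ _ := hk
  calc _ ≤ ∑ a : ShellConfig N K, ∑ b : ShellConfig N K, (excitedPurity r ^ K) ^ 2 :=
        Finset.sum_le_sum fun a _ => Finset.sum_le_sum fun b _ => hab a b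
    _ = _ := by simp; ring

theorem le_pairTrace_shellKernel {r : ℝ} (hr : r ∈ Set.Icc (0 : ℝ) 1) :
    (Fintype.card (ShellConfig N K) : ℝ) ^ 2 * excitedPurity r ^ K / 2 ^ min K (N - K)
      ≤ 2 * pairTrace (shellKernel N K r) := by
  calc _ = ∑ a : ShellConfig N K, ∑ b : ShellConfig N K,
          excitedPurity r ^ K / 2 ^ min K (N - K) := by simp; ring
    _ ≤ ∑ a : ShellConfig N K, ∑ b : ShellConfig N K, 2 * shellKernel N K r a b a b := by
        refine Finset.sum_le_sum fun a _ => Finset.sum_le_sum fun b _ => ?_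
        rw [shellKernel, mul_div_cancel₀ _ two_ne_zero]
        exact le_kernel_add_kernel hr a.2 b.2
    _ = _ := by simp only [pairTrace, Finset.mul_sum]

theorem pairTrace_shellKernel_le {r : ℝ} (hr : r ∈ Set.Icc (0 : ℝ) 1) :
    pairTrace (shellKernel N K r) ≤ (Fintype.card (ShellConfig N K) : ℝ) ^ 2 := by
  calc _ ≤ ∑ a : ShellConfig N K, ∑ b : ShellConfig N K, (1 : ℝ) := by
        refine Finset.sum_le_sum fun a _ => Finset.sum_le_sum fun b _ => ?_
        rw [shellKernel]
        linarith [kernel_le_one hr a.1 b.1 a.1 b.1, kernel_le_one hr a.1 b.1 b.1 a.1]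
    _ = _ := by simp [sq]

theorem exists_perm_of_excitations_eq {s t : Config N} (h : excitations s = excitations t) :
    ∃ σ : Equiv.Perm (Fin N), s ∘ σ = t := by
  refine exists_perm_comp_eq fun i => ?_
  have h1 := excitations_add_card_ground s
  have h2 := excitations_add_card_ground t
  rw [Fintype.card_subtype, Fintype.card_subtype]
  fin_cases i
  · simp only [Fin.zero_eta]; omega
  · exact h

theorem excitations_comp (s : Config N) (σ : Equiv.Perm (Fin N)) :
    excitations (s ∘ σ) = excitations s := by
  rw [excitations, excitations, ← Fintype.card_subtype, ← Fintype.card_subtype]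
  exact Fintype.card_congr (σ.subtypeEquiv fun n => by simp)

/-- Relabelling the qubits, as a permutation of the shell configurations. -/
def relabel (σ : Equiv.Perm (Fin N)) : Equiv.Perm (ShellConfig N K) :=
  (Equiv.arrowCongr σ.symm (Equiv.refl (Fin 2))).subtypeEquiv fun s => by
    change _ ↔ excitations (s ∘ σ) = K
    rw [excitations_comp]

/-- By symmetry the partial trace of the kernel is a multiple of the identity. -/
theorem card_mul_sum_partialTrace (r : ℝ) :
    (Fintype.card (ShellConfig N K) : ℝ) * ∑ q, ∑ u, partialTrace (shellKernel N K r) q u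
      * partialTrace (shellKernel N K r) u q = pairTrace (shellKernel N K r) ^ 2 := by
  set R := fun q => partialTrace (shellKernel N K r) q q with hR
  have hoff : ∀ q u : ShellConfig N K, q ≠ u → partialTrace (shellKernel N K r) q u = 0 := by
    intro q u hqu
    refine Finset.sum_eq_zero fun p _ => ?_
    have := kernel_eq_zero r (fun h => hqu (Subtype.ext h)) p.1
    rw [shellKernel, this.1, this.2]
    norm_num
  -- A permutation of the qubits carries q to u, leaves the kernel invariant and merely relabels the
  -- configuration being traced out.
  have hdiag : ∀ q u : ShellConfig N K, R q = R u := by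
    intro q u
    obtain ⟨σ, hσ⟩ := exists_perm_of_excitations_eq (q.2.trans u.2.symm)
    refine Fintype.sum_equiv (relabel σ) _ _ fun p => ?_
    have hp : (relabel σ p).1 = p.1 ∘ σ := rfl
    rw [shellKernel, shellKernel, hp, ← hσ, kernel_comp_perm, kernel_comp_perm]
  have h1 : ∑ q, ∑ u, partialTrace (shellKernel N K r) q u
      * partialTrace (shellKernel N K r) u q = ∑ q, R q ^ 2 := by
    refine Finset.sum_congr rfl fun q _ => ?_
    rw [Finset.sum_eq_single q (fun u _ hu => by rw [hoff q u hu.symm, zero_mul]) (by simp), sq]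
  have h2 : pairTrace (shellKernel N K r) = ∑ q, R q := by
    rw [pairTrace, Finset.sum_comm]
    rfl
  rw [h1, h2]
  rcases isEmpty_or_nonempty (ShellConfig N K) with he | ⟨⟨q₀⟩⟩
  · simp
  · simp only [hdiag _ q₀, Finset.sum_const, Finset.card_univ, nsmul_eq_mul]
    ring

theorem card_shellConfig (N K : ℕ) : Fintype.card (ShellConfig N K) = N.choose K := by
  rw [← Fintype.card_fin N, ← Fintype.card_finset_len, Fintype.card_fin]
  refine Fintype.card_congr ⟨fun s => ⟨Finset.univ.filter fun n => s.1 n = 1, s.2⟩,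
    fun t => ⟨fun n => if n ∈ t.1 then 1 else 0, ?_⟩, fun s => ?_, fun t => ?_⟩
  · have h : (Finset.univ.filter fun n => (if n ∈ t.1 then (1 : Fin 2) else 0) = 1) = t.1 := by
      ext n
      simp
    rw [excitations, h, t.2]
  · ext n
    simp only [Finset.mem_filter, Finset.mem_univ, true_and]
    split_ifs <;> omega
  · ext n
    simp

theorem four_pow_le_card_shellConfig (hK : K ≤ N) :
    4 ^ min K (N - K) ≤ (2 * min K (N - K) + 1) * Fintype.card (ShellConfig N K) := by
  set m := min K (N - K) with hm
  have h1 : N.choose K = N.choose m := by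
    rcases min_choice K (N - K) with h | h
    · rw [hm, h]
    · rw [hm, h, Nat.choose_symm hK]
  have h2 : m.centralBinom ≤ N.choose m := by
    rw [Nat.centralBinom_eq_two_mul_choose]
    exact Nat.choose_le_choose m (by omega)
  -- The usual factor is 2m; the extra 1 covers m = 0.
  have h3 : 4 ^ m ≤ (2 * m + 1) * m.centralBinom := by
    rcases Nat.eq_zero_or_pos m with h | h
    · simp [h]
    · exact (Nat.four_pow_le_two_mul_self_mul_centralBinom m h).trans
        (Nat.mul_le_mul_right _ (by omega))
  rw [card_shellConfig, h1]
  exact h3.trans (Nat.mul_le_mul_left _ h2)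

end ShellKernel

/-! ### Mean and relative variance of the purity. -/

section PurityMoments

variable {N K : ℕ}

theorem quarticForm_eq {ι : Type*} [Fintype ι] (S : ι → ι → ι → ι → ℝ) (z : ι → ℂ) :
    quarticForm S z = ∑ a, ∑ b, ∑ c, ∑ d, (S a b c d : ℂ)
      * (z a * z b * conj (z c) * conj (z d)) := by
  simp only [quarticForm, sum_fin_two_arrow, monomial, Fin.prod_univ_two]
  refine Finset.sum_congr rfl fun a _ => Finset.sum_congr rfl fun b _ =>
    Finset.sum_congr rfl fun c _ => Finset.sum_congr rfl fun d _ => ?_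
  simp only [Matrix.cons_val_zero, Matrix.cons_val_one]
  ring

theorem purity_eq_quarticForm {r : ℝ} (hr : r ∈ Set.Icc (0 : ℝ) 1) {φ : QubitSpace N}
    (hφ : ∀ s, excitations s ≠ K → φ s = 0) :
    (purity (dampingChannel N r (pureState φ)) : ℂ)
      = quarticForm (shellKernel N K r) fun a => φ a.1 := by
  have hsub : ∀ f : Config N → ℂ, (∀ s, excitations s ≠ K → f s = 0) →
      ∑ s, f s = ∑ a : ShellConfig N K, f a.1 := fun f hf => by
    rw [sum_shellConfig, Finset.sum_filter]
    exact Finset.sum_congr rfl fun s _ => by split_ifs with h <;> simp_all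
  have h1 : (purity (dampingChannel N r (pureState φ)) : ℂ)
      = ∑ a : ShellConfig N K, ∑ b : ShellConfig N K, ∑ c : ShellConfig N K,
        ∑ d : ShellConfig N K, (kernel r a.1 b.1 c.1 d.1 : ℂ)
          * (φ a.1 * φ b.1 * conj (φ c.1) * conj (φ d.1)) := by
    rw [purity_eq_kernel_sum hr, hsub _ fun s hs => by simp [hφ s hs]]
    refine Finset.sum_congr rfl fun a _ => ?_
    rw [hsub _ fun s hs => by simp [hφ s hs]]
    refine Finset.sum_congr rfl fun b _ => ?_
    rw [hsub _ fun s hs => by simp [hφ s hs]]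
    refine Finset.sum_congr rfl fun c _ => ?_
    rw [hsub _ fun s hs => by simp [hφ s hs]]
  rw [quarticForm_eq, h1]
  refine Finset.sum_congr rfl fun a _ => Finset.sum_congr rfl fun b _ => ?_
  -- The monomial is symmetric in c and d, so symmetrizing the kernel leaves the form unchanged.
  have h2 : ∑ c : ShellConfig N K, ∑ d : ShellConfig N K, (kernel r a.1 b.1 c.1 d.1 : ℂ)
          * (φ a.1 * φ b.1 * conj (φ c.1) * conj (φ d.1))
      = ∑ c : ShellConfig N K, ∑ d : ShellConfig N K, (kernel r a.1 b.1 d.1 c.1 : ℂ)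
          * (φ a.1 * φ b.1 * conj (φ c.1) * conj (φ d.1)) := by
    rw [Finset.sum_comm]
    exact Finset.sum_congr rfl fun c _ => Finset.sum_congr rfl fun d _ => by ring
  have h3 : ∀ x y : ℂ, x = y → x = (x + y) / 2 := fun x y h => by rw [h]; ring
  rw [h3 _ _ h2, ← Finset.sum_add_distrib, Finset.sum_div]
  refine Finset.sum_congr rfl fun c _ => ?_
  rw [← Finset.sum_add_distrib, Finset.sum_div]
  refine Finset.sum_congr rfl fun d _ => ?_
  rw [shellKernel]
  push_cast
  ring

variable {S : Submodule ℂ (QubitSpace N)}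
  (hS : ∀ ψ, ψ ∈ S ↔ ∀ s, excitations s ≠ K → ψ s = 0) {ψ₀ : S} (hψ₀ : ‖ψ₀‖ = 1)
  {r : ℝ} (hr : r ∈ Set.Icc (0 : ℝ) 1)

theorem continuous_purity_outputState :
    Continuous fun U : UnitaryGroup S => purity (outputState S ψ₀ r U) := by
  have h : Continuous fun U : UnitaryGroup S => ((U.1 ψ₀ : S) : QubitSpace N).ofLp := by
    have h1 : Continuous fun U : UnitaryGroup S => U.1 ψ₀ :=
      continuous_subtype_val.clm_apply continuous_const
    fun_prop
  unfold outputState purity dampingChannel pureState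
  refine Complex.continuous_re.comp (Continuous.matrix_trace (Continuous.pow ?_ 2))
  refine continuous_finsetSum _ fun k _ => ?_
  exact (continuous_const.matrix_mul (h.matrix_vecMulVec (continuous_star.comp h))).matrix_mul
    continuous_const

include hψ₀ hr in
theorem two_pow_neg_le_purity_outputState (U : UnitaryGroup S) :
    ((2 : ℝ) ^ N)⁻¹ ≤ purity (outputState S ψ₀ r U) := by
  refine two_pow_neg_le_purity hr ?_
  rw [← hψ₀, Submodule.norm_coe]
  exact (Unitary.linearIsometryEquiv U).norm_map ψ₀

include hS hψ₀ hr in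
theorem purity_outputState_moments :
    (((Fintype.card (ShellConfig N K) : ℝ) ^ 2 + Fintype.card (ShellConfig N K))
      * meanPurity S ψ₀ r = 2 * pairTrace (shellKernel N K r)) ∧
    (Fintype.card (ShellConfig N K) : ℝ) ^ 4
        * ∫ U, purity (outputState S ψ₀ r U) ^ 2 ∂(haar S)
      ≤ 4 * pairTrace (shellKernel N K r) ^ 2
        + 4 * ((Fintype.card (ShellConfig N K) : ℝ) ^ 2 * (excitedPurity r ^ K) ^ 2)
        + 16 * ∑ q, ∑ u, partialTrace (shellKernel N K r) q u
          * partialTrace (shellKernel N K r) u q := by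
  obtain ⟨b, hb⟩ := exists_shell_basis hS
  have hX : ∀ U : UnitaryGroup S, (purity (outputState S ψ₀ r U) : ℂ)
      = quarticForm (shellKernel N K r) (b.repr (U.1 ψ₀)) := fun U => by
    have : (b.repr (U.1 ψ₀)).ofLp = fun a => ((U.1 ψ₀ : S) : QubitSpace N) a.1 :=
      funext fun a => hb _ a
    rw [this, outputState, purity_eq_quarticForm hr ((hS _).1 (U.1 ψ₀ : S).2)]
  refine ⟨integral_quarticForm b hψ₀ hX (shellKernel_swap_right r),
    (integral_quarticForm_sq_le b hψ₀ hX (shellKernel_swap_left r)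
      (shellKernel_swap_right r)).trans ?_⟩
  gcongr
  exact sum_shellKernel_sq_le r

/-- The elementary inequality behind the bound on the relative variance. -/
theorem relative_variance_arith {d t Q n M g E₁ E₂ W : ℝ} (hd : 1 ≤ d) (hn : 1 ≤ n) (hM : 0 < M)
    (hg : 0 ≤ g) (hE₁ : (d ^ 2 + d) * E₁ = 2 * t) (hE₂ : d ^ 4 * E₂ ≤ 4 * t ^ 2 + 4 * Q + 16 * W)
    (hQ : Q = d ^ 2 * g ^ 2) (ht : d ^ 2 * g / M ≤ 2 * t) (hM2 : M ^ 2 ≤ n * d)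
    (hW : d * W = t ^ 2) :
    E₂ - E₁ ^ 2 ≤ 35 * n ^ 2 / M ^ 2 * E₁ ^ 2 := by
  have hd0 : 0 < d := by linarith
  have hQt : d * Q ≤ 4 * n * t ^ 2 := by
    rw [div_le_iff₀ hM] at ht
    have h1 : (d ^ 2 * g) ^ 2 ≤ (2 * t * M) ^ 2 := by gcongr
    have h2 : (2 * t * M) ^ 2 ≤ 4 * t ^ 2 * (n * d) := by
      rw [show (2 * t * M) ^ 2 = 4 * t ^ 2 * M ^ 2 by ring]
      gcongr
    have h3 : d * (d * Q) ≤ d * (4 * n * t ^ 2) := by rw [hQ]; nlinarith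
    exact le_of_mul_le_mul_left h3 hd0
  have hE2 : d ^ 5 * E₂ ≤ (d + 4 * n + 4) * (4 * t ^ 2) := by
    have : d * (d ^ 4 * E₂) ≤ d * (4 * t ^ 2 + 4 * Q + 16 * W) := by gcongr
    nlinarith
  have ht2 : 4 * t ^ 2 = d ^ 2 * ((d + 1) ^ 2 * E₁ ^ 2) := by
    calc 4 * t ^ 2 = (2 * t) ^ 2 := by ring
      _ = _ := by rw [← hE₁]; ring
  have h3 : d ^ 3 * E₂ ≤ (d + 4 * n + 4) * (d + 1) ^ 2 * E₁ ^ 2 := by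
    rw [ht2] at hE2
    have : d ^ 2 * (d ^ 3 * E₂) ≤ d ^ 2 * ((d + 4 * n + 4) * (d + 1) ^ 2 * E₁ ^ 2) := by
      nlinarith
    exact le_of_mul_le_mul_left this (by positivity)
  -- The constant 35 comes from bounding all lower-order terms by n d², using d, n ≥ 1; equality
  -- holds at d = n = 1.
  have h4 : (d + 4 * n + 4) * (d + 1) ^ 2 ≤ d ^ 3 + 35 * n * d ^ 2 := by
    have ha : 1 * d ≤ d * d := by gcongr
    have hb : 1 * d ≤ n * d := by gcongr
    have hc : n * (1 * d) ≤ n * (d * d) := by gcongr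
    have hd' : 1 * (d * d) ≤ n * (d * d) := by gcongr
    nlinarith
  have h5 : d * E₂ ≤ (d + 35 * n) * E₁ ^ 2 := by
    have : d ^ 2 * (d * E₂) ≤ d ^ 2 * ((d + 35 * n) * E₁ ^ 2) := by
      nlinarith [mul_le_mul_of_nonneg_right h4 (sq_nonneg E₁)]
    exact le_of_mul_le_mul_left this (by positivity)
  have h6 : d * (E₂ - E₁ ^ 2) ≤ 35 * n * E₁ ^ 2 := by linarith
  rw [div_mul_eq_mul_div, le_div_iff₀ (by positivity)]
  rcases le_or_gt (E₂ - E₁ ^ 2) 0 with h | h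
  · exact (mul_nonpos_of_nonpos_of_nonneg h (by positivity)).trans (by positivity)
  · calc (E₂ - E₁ ^ 2) * M ^ 2 ≤ (E₂ - E₁ ^ 2) * (n * d) := by gcongr
      _ = n * (d * (E₂ - E₁ ^ 2)) := by ring
      _ ≤ n * (35 * n * E₁ ^ 2) := by gcongr
      _ = _ := by ring

include hψ₀ hr in
theorem meanPurity_pos : 0 < meanPurity S ψ₀ r := by
  have h : ((2 : ℝ) ^ N)⁻¹ ≤ meanPurity S ψ₀ r := by
    calc ((2 : ℝ) ^ N)⁻¹ = ∫ _ : UnitaryGroup S, ((2 : ℝ) ^ N)⁻¹ ∂(haar S) := by simp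
      _ ≤ _ := integral_mono (integrable_const _)
        (integrable_haar_of_continuous continuous_purity_outputState)
        (two_pow_neg_le_purity_outputState hψ₀ hr)
  exact lt_of_lt_of_le (by positivity) h

include hS hψ₀ hr in
theorem meanPurity_le_two (hK : K ≤ N) : meanPurity S ψ₀ r ≤ 2 := by
  have h := (purity_outputState_moments hS hψ₀ hr).1
  have ht := pairTrace_shellKernel_le (N := N) (K := K) hr
  have hd : (1 : ℝ) ≤ Fintype.card (ShellConfig N K) := by
    rw [card_shellConfig]; exact_mod_cast Nat.choose_pos hK
  have hpos := meanPurity_pos hψ₀ hr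
  generalize (Fintype.card (ShellConfig N K) : ℝ) = d at h ht hd
  by_contra! hlt
  nlinarith [mul_pos (show 0 < d by linarith) hpos, mul_lt_mul_of_pos_left hlt
    (show 0 < d ^ 2 by positivity)]

include hS hψ₀ hr in
/-- The relative variance of the purity is exponentially small in `min K (N - K)`. -/
theorem variance_purity_le (hK : K ≤ N) :
    ∫ U, (purity (outputState S ψ₀ r U) - meanPurity S ψ₀ r) ^ 2 ∂(haar S)
      ≤ 35 * (2 * (min K (N - K) : ℕ) + 1) ^ 2 / (2 ^ min K (N - K)) ^ 2
        * meanPurity S ψ₀ r ^ 2 := by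
  obtain ⟨h1, h2⟩ := purity_outputState_moments hS hψ₀ hr
  have hc := continuous_purity_outputState (S := S) (ψ₀ := ψ₀) (r := r)
  have hvar : ∫ U, (purity (outputState S ψ₀ r U) - meanPurity S ψ₀ r) ^ 2 ∂(haar S)
      = ∫ U, purity (outputState S ψ₀ r U) ^ 2 ∂(haar S) - meanPurity S ψ₀ r ^ 2 := by
    have hE : ∀ U, (purity (outputState S ψ₀ r U) - meanPurity S ψ₀ r) ^ 2
        = purity (outputState S ψ₀ r U) ^ 2
          - 2 * meanPurity S ψ₀ r * purity (outputState S ψ₀ r U) + meanPurity S ψ₀ r ^ 2 :=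
      fun U => by ring
    simp only [hE]
    rw [integral_add, integral_sub, integral_const_mul, integral_const, probReal_univ, one_smul]
    · change _ - 2 * _ * meanPurity S ψ₀ r + _ = _
      ring
    all_goals exact integrable_haar_of_continuous (by fun_prop)
  rw [hvar]
  have hd : (1 : ℝ) ≤ Fintype.card (ShellConfig N K) := by
    rw [card_shellConfig]; exact_mod_cast Nat.choose_pos hK
  refine relative_variance_arith (d := (Fintype.card (ShellConfig N K) : ℝ)) hd (by simp) (by positivity)
    (pow_nonneg (excitedPurity_pos r).le K) h1 h2 rfl (le_pairTrace_shellKernel hr) ?_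
    (card_mul_sum_partialTrace r)
  calc ((2 : ℝ) ^ min K (N - K)) ^ 2 = 4 ^ min K (N - K) := by
        rw [← pow_mul, mul_comm, pow_mul]; norm_num
    _ ≤ _ := by exact_mod_cast four_pow_le_card_shellConfig hK

end PurityMoments

/-! ### From relative variance to the logarithm. -/

section Concentration

/-- For p ≥ 1/2 the left side is at most (p-1)²/p. Below 1/2 it is at most L, while (p-1)² is at
least 1/4. -/
theorem sub_one_sub_log_le {p L : ℝ} (hL : 0 ≤ L) (hp : Real.exp (-L) ≤ p) :
    -Real.log p + p - 1 ≤ (2 + 4 * L) * (p - 1) ^ 2 := by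
  have hp0 : 0 < p := (Real.exp_pos _).trans_le hp
  rcases le_or_gt (1 / 2) p with h | h
  · have h1 := Real.one_sub_inv_le_log_of_pos hp0
    have h2 : p⁻¹ + p - 2 ≤ 2 * (p - 1) ^ 2 := by
      have e : p⁻¹ + p - 2 = p⁻¹ * (p - 1) ^ 2 := by field_simp; ring
      have hle : p⁻¹ ≤ 2 := by
        rw [inv_le_comm₀ hp0 two_pos]; linarith
      rw [e]
      exact mul_le_mul_of_nonneg_right hle (sq_nonneg _)
    nlinarith [mul_nonneg hL (sq_nonneg (p - 1))]
  · have h1 : -L ≤ Real.log p := (Real.le_log_iff_exp_le hp0).2 hp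
    have h2 : 1 / 4 ≤ (p - 1) ^ 2 := by nlinarith
    nlinarith [mul_le_mul_of_nonneg_left h2 hL]

theorem sub_one_sub_log_nonneg {p : ℝ} (hp : 0 < p) : 0 ≤ -Real.log p + p - 1 := by
  linarith [Real.log_le_sub_one_of_pos hp]

variable {Ω : Type*} [MeasurableSpace Ω] {μ : Measure Ω} [IsProbabilityMeasure μ]
  {X : Ω → ℝ} {L s : ℝ}

/-- Small relative variance and a crude lower bound control the logarithm. -/
theorem log_concentration (hX : Integrable X μ) (hX2 : Integrable (fun ω => (X ω - (∫ ω, X ω ∂μ)) ^ 2) μ)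
    (hlog : Integrable (fun ω => Real.log (X ω)) μ) (hm : 0 < (∫ ω, X ω ∂μ)) (hL : 0 ≤ L)
    (hlow : ∀ ω, Real.exp (-L) * (∫ ω, X ω ∂μ) ≤ X ω) (hs : 0 < s)
    (hvar : ∫ ω, (X ω - (∫ ω, X ω ∂μ)) ^ 2 ∂μ ≤ s ^ 2 * (∫ ω, X ω ∂μ) ^ 2) :
    |(∫ ω, -Real.log (X ω) ∂μ) - -Real.log (∫ ω, X ω ∂μ)| ≤ (2 + 4 * L) * s ^ 2 ∧
    ∫ ω, |-Real.log (X ω) - -Real.log (∫ ω, X ω ∂μ)| ∂μ ≤ (2 + 4 * L) * s ^ 2 + s := by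
  set m := ∫ ω, X ω ∂μ with hmdef
  have hp : ∀ ω, 0 < X ω := fun ω => (mul_pos (Real.exp_pos _) hm).trans_le (hlow ω)
  have hlogp : ∀ ω, -Real.log (X ω / m) = -Real.log (X ω) - -Real.log m := fun ω => by
    rw [Real.log_div (hp ω).ne' hm.ne']; ring
  have hpl : ∀ ω, Real.exp (-L) ≤ X ω / m := fun ω => (le_div_iff₀ hm).2 (hlow ω)
  have hsq : ∀ ω, (X ω / m - 1) ^ 2 = (X ω - m) ^ 2 / m ^ 2 := fun ω => by
    field_simp
  have hi1 : Integrable (fun ω => -Real.log (X ω / m)) μ := by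
    simp only [hlogp]; exact hlog.neg.sub (integrable_const _)
  have hi2 : Integrable (fun ω => X ω / m) μ := hX.div_const m
  have hi3 : Integrable (fun ω => (X ω / m - 1) ^ 2) μ := by
    simp only [hsq]; exact hX2.div_const _
  have hi4 : Integrable (fun ω => -Real.log (X ω / m) + X ω / m - 1) μ :=
    (hi1.add hi2).sub (integrable_const _)
  have hv : ∫ ω, (X ω / m - 1) ^ 2 ∂μ ≤ s ^ 2 := by
    simp only [hsq]
    rw [integral_div, div_le_iff₀ (by positivity)]
    exact hvar
  have hmean : ∫ ω, X ω / m ∂μ = 1 := by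
    rw [integral_div]; exact div_self hm.ne'
  have hgap : ∫ ω, (-Real.log (X ω / m) + X ω / m - 1) ∂μ ≤ (2 + 4 * L) * s ^ 2 := by
    calc _ ≤ ∫ ω, (2 + 4 * L) * (X ω / m - 1) ^ 2 ∂μ :=
          integral_mono hi4 (hi3.const_mul _) fun ω => sub_one_sub_log_le hL (hpl ω)
      _ = (2 + 4 * L) * ∫ ω, (X ω / m - 1) ^ 2 ∂μ := integral_const_mul _ _
      _ ≤ _ := by gcongr
  -- The linear terms cancel on average because X/m has mean 1; what remains is the Jensen gap.
  have hgap' : ∫ ω, (-Real.log (X ω / m) + X ω / m - 1) ∂μ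
      = (∫ ω, -Real.log (X ω) ∂μ) - -Real.log m := by
    have hi12 : Integrable (fun ω => -Real.log (X ω / m) + X ω / m) μ := hi1.add hi2
    have hneg : Integrable (fun ω => -Real.log (X ω)) μ := hlog.neg
    rw [integral_sub hi12 (integrable_const _), integral_add hi1 hi2, hmean]
    simp only [hlogp]
    rw [integral_sub hneg (integrable_const _)]
    simp
  have hgap0 : 0 ≤ ∫ ω, (-Real.log (X ω / m) + X ω / m - 1) ∂μ :=
    integral_nonneg fun ω => sub_one_sub_log_nonneg (div_pos (hp ω) hm)
  refine ⟨?_, ?_⟩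
  · rw [← hgap', abs_of_nonneg hgap0]
    exact hgap
  · have hi5 : Integrable (fun ω => (X ω / m - 1) ^ 2 / (2 * s) + s / 2) μ :=
      (hi3.div_const _).add (integrable_const _)
    calc ∫ ω, |-Real.log (X ω) - -Real.log m| ∂μ
        ≤ ∫ ω, ((-Real.log (X ω / m) + X ω / m - 1) + ((X ω / m - 1) ^ 2 / (2 * s) + s / 2)) ∂μ := by
          refine integral_mono ?_ (hi4.add hi5) fun ω => ?_
          · simp only [← hlogp]; exact hi1.abs
          · simp only [← hlogp]
            -- The arithmetic–geometric mean inequality with weight s, so that integration gives at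
            -- most s/2 + s/2.
            have h1 : |X ω / m - 1| ≤ (X ω / m - 1) ^ 2 / (2 * s) + s / 2 := by
              rw [← sq_abs (X ω / m - 1)]
              have : 0 ≤ (|X ω / m - 1| - s) ^ 2 / (2 * s) := by positivity
              have e : (|X ω / m - 1| - s) ^ 2 / (2 * s)
                = |X ω / m - 1| ^ 2 / (2 * s) + s / 2 - |X ω / m - 1| := by
                field_simp; ring
              linarith
            have h2 := sub_one_sub_log_nonneg (div_pos (hp ω) hm)
            have h3 : |-Real.log (X ω / m)| ≤ (-Real.log (X ω / m) + X ω / m - 1)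
                + |X ω / m - 1| := by
              rw [abs_le]
              constructor <;> linarith [neg_abs_le (X ω / m - 1), le_abs_self (X ω / m - 1)]
            linarith
      _ = ∫ ω, (-Real.log (X ω / m) + X ω / m - 1) ∂μ
          + ((∫ ω, (X ω / m - 1) ^ 2 ∂μ) / (2 * s) + s / 2) := by
          rw [integral_add hi4 hi5, integral_add (hi3.div_const _) (integrable_const _),
            integral_div]
          simp
      _ ≤ (2 + 4 * L) * s ^ 2 + (s ^ 2 / (2 * s) + s / 2) := by gcongr
      _ = _ := by field_simp; ring

/-- Markov's inequality for the deviation from the mean, through any other centre. -/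
theorem measureReal_deviation_le {Y : Ω → ℝ} (hY : Integrable Y μ) (a : ℝ) {B ε : ℝ} (hε : 0 < ε)
    (hB : ∫ ω, |Y ω - a| ∂μ ≤ B) : μ.real {ω | ε ≤ |Y ω - (∫ ω, Y ω ∂μ)|} ≤ 2 * B / ε := by
  have hi : Integrable (fun ω => |Y ω - a|) μ := (hY.sub (integrable_const a)).abs
  have h1 : |(∫ ω, Y ω ∂μ) - a| ≤ B := by
    calc |(∫ ω, Y ω ∂μ) - a| = |∫ ω, (Y ω - a) ∂μ| := by
          rw [integral_sub hY (integrable_const a)]; simp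
      _ ≤ ∫ ω, |Y ω - a| ∂μ := abs_integral_le_integral_abs
      _ ≤ B := hB
  have h2 : ∫ ω, |Y ω - (∫ ω, Y ω ∂μ)| ∂μ ≤ 2 * B := by
    calc ∫ ω, |Y ω - (∫ ω, Y ω ∂μ)| ∂μ ≤ ∫ ω, (|Y ω - a| + B) ∂μ := by
          refine integral_mono (hY.sub (integrable_const _)).abs (hi.add (integrable_const _))
            fun ω => ?_
          have := abs_sub_le (Y ω) a (∫ ω, Y ω ∂μ)
          rw [abs_sub_comm a] at this
          linarith
      _ = ∫ ω, |Y ω - a| ∂μ + B := by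
          rw [integral_add hi (integrable_const _)]; simp
      _ ≤ 2 * B := by linarith
  rw [le_div_iff₀ hε, mul_comm]
  exact (mul_meas_ge_le_integral_of_nonneg (Filter.Eventually.of_forall fun ω => abs_nonneg _)
    (hY.sub (integrable_const _)).abs ε).trans h2

/-- Half of the decay rate is spent on absorbing the polynomial, through y³/3! ≤ exp y at y =
a(N+1)/2. -/
theorem cube_mul_exp_le {a : ℝ} (ha : 0 < a) (N : ℕ) :
    ((N : ℝ) + 1) ^ 3 * Real.exp (-a * N)
      ≤ 6 * Real.exp (a / 2) / (a / 2) ^ 3 * Real.exp (-(a / 2) * N) := by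
  have h := Real.pow_div_factorial_le_exp (a / 2 * (N + 1)) (by positivity) 3
  have h1 : ((N : ℝ) + 1) ^ 3 ≤ 6 / (a / 2) ^ 3 * Real.exp (a / 2 * (N + 1)) := by
    rw [div_mul_eq_mul_div, le_div_iff₀ (by positivity)]
    rw [div_le_iff₀ (by positivity)] at h
    norm_num [Nat.factorial] at h ⊢
    linarith
  calc _ ≤ 6 / (a / 2) ^ 3 * Real.exp (a / 2 * (N + 1)) * Real.exp (-a * N) := by gcongr
    _ = 6 / (a / 2) ^ 3 * (Real.exp (a / 2) * Real.exp (-(a / 2) * N)) := by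
        rw [mul_assoc, ← Real.exp_add, ← Real.exp_add]
        congr 2
        ring
    _ = _ := by ring

end Concentration

/-! ### Finite-size estimates and the one-dimensional shell. -/

section Typicality

variable {N K : ℕ} {S : Submodule ℂ (QubitSpace N)} {ψ₀ : S} {r : ℝ}

theorem sdPurity_eq : sdPurity S ψ₀ r
    = Real.sqrt (∫ U, (purity (outputState S ψ₀ r U) - meanPurity S ψ₀ r) ^ 2 ∂(haar S)) := by
  rw [sdPurity, ProbabilityTheory.variance_eq_integral
    (continuous_purity_outputState.measurable.aemeasurable)]
  rfl

variable (hS : ∀ ψ, ψ ∈ S ↔ ∀ s, excitations s ≠ K → ψ s = 0) (hψ₀ : ‖ψ₀‖ = 1)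
  (hr : r ∈ Set.Icc (0 : ℝ) 1)

include hψ₀ hr in
theorem integrable_log_purity :
    Integrable (fun U => Real.log (purity (outputState S ψ₀ r U))) (haar S) :=
  integrable_haar_of_continuous (continuous_purity_outputState.log fun U =>
    (lt_of_lt_of_le (by positivity) (two_pow_neg_le_purity_outputState hψ₀ hr U)).ne')

include hS hψ₀ hr in
/-- Typicality at finite size. -/
theorem typicality_finite (hK : K ≤ N) {s : ℝ} (hs : 0 < s)
    (hsN : 6 * ((N : ℝ) + 1) / 2 ^ min K (N - K) ≤ s) :
    sdPurity S ψ₀ r / meanPurity S ψ₀ r ≤ s ∧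
    |meanRenyiTwo S ψ₀ r - -Real.log (meanPurity S ψ₀ r)| ≤ 6 * ((N : ℝ) + 1) * s ^ 2 ∧
    ∀ ε > (0 : ℝ), (haar S).real {U | ε ≤ |renyiTwo (outputState S ψ₀ r U) - meanRenyiTwo S ψ₀ r|}
      ≤ 2 * (6 * ((N : ℝ) + 1) * s ^ 2 + s) / ε := by
  have hm := meanPurity_pos hψ₀ hr
  have hvar : ∫ U, (purity (outputState S ψ₀ r U) - meanPurity S ψ₀ r) ^ 2 ∂(haar S)
      ≤ s ^ 2 * meanPurity S ψ₀ r ^ 2 := by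
    refine (variance_purity_le hS hψ₀ hr hK).trans (mul_le_mul_of_nonneg_right ?_ (sq_nonneg _))
    refine le_trans ?_ (pow_le_pow_left₀ (by positivity) hsN 2)
    rw [div_pow]
    gcongr
    -- Here 2 min(K, N-K) ≤ N, and 35 is rounded up to 36 = 6², the source of the 6 in the condition
    -- on s.
    have : (2 * (min K (N - K) : ℕ) + 1 : ℝ) ≤ N + 1 := by
      have : 2 * min K (N - K) + 1 ≤ N + 1 := by omega
      exact_mod_cast this
    calc 35 * (2 * ((min K (N - K) : ℕ) : ℝ) + 1) ^ 2 ≤ 36 * ((N : ℝ) + 1) ^ 2 := by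
          gcongr; norm_num
      _ = _ := by ring
  -- With e ≥ 2, the exponent N+1 rather than N pays for the bound 2 on the mean.
  have hlow : ∀ U, Real.exp (-((N : ℝ) + 1)) * meanPurity S ψ₀ r
      ≤ purity (outputState S ψ₀ r U) := fun U => by
    refine le_trans ?_ (two_pow_neg_le_purity_outputState hψ₀ hr U)
    calc Real.exp (-((N : ℝ) + 1)) * meanPurity S ψ₀ r
        ≤ ((2 : ℝ) ^ (N + 1))⁻¹ * 2 := by
          gcongr
          · rw [Real.exp_neg]
            gcongr
            calc (2 : ℝ) ^ (N + 1) ≤ Real.exp 1 ^ (N + 1) := by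
                  gcongr; linarith [Real.add_one_le_exp 1]
              _ = _ := by rw [← Real.exp_nat_mul]; simp
          · exact meanPurity_le_two hS hψ₀ hr hK
      _ = _ := by rw [pow_succ]; field_simp
  have hlog := integrable_log_purity hψ₀ hr
  obtain ⟨h1, h2⟩ := log_concentration (L := (N : ℝ) + 1)
    (integrable_haar_of_continuous continuous_purity_outputState)
    (integrable_haar_of_continuous
      ((continuous_purity_outputState.sub continuous_const).pow 2)) hlog hm (by positivity)
    hlow hs hvar
  have hC : (2 + 4 * ((N : ℝ) + 1)) * s ^ 2 ≤ 6 * ((N : ℝ) + 1) * s ^ 2 := by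
    gcongr
    have : (0 : ℝ) ≤ N := by positivity
    linarith
  refine ⟨?_, h1.trans hC, fun ε hε => ?_⟩
  · rw [div_le_iff₀ hm, sdPurity_eq]
    refine Real.sqrt_le_iff.2 ⟨by positivity, ?_⟩
    rw [mul_pow]
    exact hvar
  · exact measureReal_deviation_le hlog.neg _ hε (h2.trans (by linarith))

include hS hψ₀ in
/-- On a one-dimensional shell the purity does not fluctuate. -/
theorem purity_outputState_const (hd : Fintype.card (ShellConfig N K) = 1) (U : UnitaryGroup S) :
    purity (outputState S ψ₀ r U) = purity (outputState S ψ₀ r 1) := by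
  obtain ⟨b, -⟩ := exists_shell_basis hS
  have hfin : Module.finrank ℂ S = 1 := by
    rw [Module.finrank_eq_card_basis b.toBasis, hd]
  have hne : ψ₀ ≠ 0 := fun h => by simp [h] at hψ₀
  obtain ⟨c, hc⟩ := exists_smul_eq_of_finrank_eq_one hfin hne (U.1 ψ₀)
  have hc1 : ‖c‖ = 1 := by
    have h := (Unitary.linearIsometryEquiv U).norm_map ψ₀
    change ‖U.1 ψ₀‖ = _ at h
    rwa [← hc, norm_smul, hψ₀, mul_one] at h
  -- In dimension one the unitary acts by a phase, which cancels in the rank-one projection.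
  have hpure : pureState (U.1 ψ₀ : QubitSpace N) = pureState (ψ₀ : QubitSpace N) := by
    ext s t
    have : c * star c = 1 := by
      rw [Complex.star_def, Complex.mul_conj, Complex.normSq_eq_norm_sq, hc1]; norm_num
    simp only [← hc, pureState, Matrix.vecMulVec_apply, Submodule.coe_smul, PiLp.smul_apply,
      Pi.star_apply, smul_eq_mul, star_mul']
    linear_combination (ψ₀ : QubitSpace N) s * star ((ψ₀ : QubitSpace N) t) * this
  unfold outputState
  rw [hpure]
  rfl

include hS hψ₀ in
theorem typicality_const (hd : Fintype.card (ShellConfig N K) = 1) :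
    sdPurity S ψ₀ r / meanPurity S ψ₀ r = 0 ∧
    |meanRenyiTwo S ψ₀ r - -Real.log (meanPurity S ψ₀ r)| = 0 ∧
    ∀ ε > (0 : ℝ), (haar S).real {U | ε ≤ |renyiTwo (outputState S ψ₀ r U) - meanRenyiTwo S ψ₀ r|}
      = 0 := by
  have hc := purity_outputState_const (r := r) hS hψ₀ hd
  have hm : meanPurity S ψ₀ r = purity (outputState S ψ₀ r 1) := by
    simp [meanPurity, hc]
  have hR : meanRenyiTwo S ψ₀ r = -Real.log (purity (outputState S ψ₀ r 1)) := by
    simp [meanRenyiTwo, renyiTwo, hc]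
  refine ⟨?_, ?_, fun ε hε => ?_⟩
  · simp [sdPurity_eq, hc, hm]
  · simp [hm, hR]
  · simp [renyiTwo, hc, hR, not_le.2 hε]

end Typicality

end QubitDissipation

/-! ### The main theorem: choice of constants. -/

theorem theorem2 (u : ℝ) (hu : u ∈ Set.Icc (0 : ℝ) 1) (r : ℝ) (hr : r ∈ Set.Icc (0 : ℝ) 1) :
    ∃ c > (0 : ℝ), ∃ C > (0 : ℝ), ∃ D : ℝ → ℝ,
      ∀ (N K : ℕ) (ω Δ : ℝ), (K : ℝ) = u * N → 0 < ω → 0 < Δ → Δ < ω →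
      ∀ (S : Submodule ℂ (QubitDissipation.QubitSpace N)),
        S = QubitDissipation.energyShell N ω (K * ω) Δ →
      ∀ ψ₀ : S, ‖ψ₀‖ = 1 →
        QubitDissipation.sdPurity S ψ₀ r / QubitDissipation.meanPurity S ψ₀ r
            ≤ C * Real.exp (-c * N) ∧
        |QubitDissipation.meanRenyiTwo S ψ₀ r - -Real.log (QubitDissipation.meanPurity S ψ₀ r)|
            ≤ C * Real.exp (-c * N) ∧
        ∀ ε > (0 : ℝ),
          (QubitDissipation.haar S).real
              {U | ε ≤ |QubitDissipation.renyiTwo (QubitDissipation.outputState S ψ₀ r U)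
                - QubitDissipation.meanRenyiTwo S ψ₀ r|}
            ≤ D ε * Real.exp (-c * N) := by
  open QubitDissipation in
  have hshell : ∀ {N K : ℕ} {ω Δ : ℝ}, 0 < ω → 0 < Δ → Δ < ω →
      ∀ {S : Submodule ℂ (QubitSpace N)}, S = energyShell N ω (K * ω) Δ →
      ∀ ψ, ψ ∈ S ↔ ∀ s, excitations s ≠ K → ψ s = 0 := by
    rintro N K ω Δ hω hΔ hΔω S rfl ψ
    exact mem_energyShell_iff hω hΔ hΔω K ψ
  rcases eq_or_lt_of_le (le_min hu.1 (sub_nonneg.2 hu.2)) with h0 | hμ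
  · refine ⟨1, one_pos, 1, one_pos, fun _ => 1, ?_⟩
    intro N K ω Δ hK hω hΔ hΔω S hS ψ₀ hψ₀
    have hd : Fintype.card (ShellConfig N K) = 1 := by
      rw [card_shellConfig]
      rcases min_choice u (1 - u) with h | h
      · have : (K : ℝ) = 0 := by rw [hK, ← h, ← h0, zero_mul]
        rw [Nat.cast_eq_zero.1 this, Nat.choose_zero_right]
      · have h1 : u = 1 := by linarith
        have : (K : ℝ) = N := by rw [hK, h1, one_mul]
        rw [Nat.cast_injective this, Nat.choose_self]
    obtain ⟨e1, e2, e3⟩ := typicality_const (r := r) (hshell hω hΔ hΔω hS) hψ₀ hd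
    refine ⟨e1.trans_le (by positivity), e2.trans_le (by positivity), fun ε hε => ?_⟩
    exact (e3 ε hε).trans_le (by positivity)
  -- Since min(K, N-K) = min(u, 1-u)N, this is the rate for which 2^(-min(K, N-K)) equals exp(-aN).
  · set a := min u (1 - u) * Real.log 2 with ha
    have ha0 : 0 < a := mul_pos hμ (Real.log_pos one_lt_two)
    set B := 6 * Real.exp (a / 2) / (a / 2) ^ 3 with hB
    have hB0 : 0 < B := by positivity
    -- With s = 6(N+1)exp(-aN), the term 6(N+1)s² produces 6³ = 216, and the probability bound 2(216
    -- + 6) = 444.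
    refine ⟨a / 2, by positivity, 216 * B, by positivity, fun ε => 444 * B / ε, ?_⟩
    intro N K ω Δ hK hω hΔ hΔω S hS ψ₀ hψ₀
    have hKN : K ≤ N := by
      have : (K : ℝ) ≤ N := by
        rw [hK]; exact mul_le_of_le_one_left (by positivity) hu.2
      exact_mod_cast this
    have hN0 : (0 : ℝ) ≤ N := by positivity
    set x := Real.exp (-a * N) with hx
    have hx0 : 0 < x := Real.exp_pos _
    have hx1 : x ≤ 1 := Real.exp_le_one_iff.2 (by nlinarith)
    have hpow : ((2 : ℝ) ^ min K (N - K))⁻¹ ≤ x := by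
      have hmin : min u (1 - u) * N ≤ (min K (N - K) : ℕ) := by
        rw [Nat.cast_min, Nat.cast_sub hKN, hK, min_mul_of_nonneg _ _ hN0, sub_mul, one_mul]
      rw [← Real.rpow_natCast, ← Real.rpow_neg two_pos.le, Real.rpow_def_of_pos two_pos, hx]
      refine Real.exp_le_exp.2 ?_
      rw [ha]
      nlinarith [Real.log_pos one_lt_two]
    have hcube := cube_mul_exp_le ha0 N
    rw [← hx, ← hB] at hcube
    have hs0 : 0 < 6 * ((N : ℝ) + 1) * x := by positivity
    obtain ⟨e1, e2, e3⟩ := typicality_finite (hshell hω hΔ hΔω hS) hψ₀ hr hKN hs0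
      (by rw [div_eq_mul_inv]; gcongr)
    have hs : 6 * ((N : ℝ) + 1) * x ≤ 6 * (((N : ℝ) + 1) ^ 3 * x) := by
      have : (N : ℝ) + 1 ≤ ((N : ℝ) + 1) ^ 3 := le_self_pow₀ (by linarith) (by norm_num)
      calc 6 * ((N : ℝ) + 1) * x = 6 * (((N : ℝ) + 1) * x) := by ring
        _ ≤ _ := by gcongr
    have hs2 : 6 * ((N : ℝ) + 1) * (6 * ((N : ℝ) + 1) * x) ^ 2
        ≤ 216 * (((N : ℝ) + 1) ^ 3 * x) := by
      calc _ = 216 * (((N : ℝ) + 1) ^ 3 * (x * x)) := by ring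
        _ ≤ 216 * (((N : ℝ) + 1) ^ 3 * (x * 1)) := by gcongr
        _ = _ := by ring
    have hBx : 0 < B * Real.exp (-(a / 2) * N) := by positivity
    refine ⟨by linarith, by linarith, fun ε hε => (e3 ε hε).trans ?_⟩
    rw [div_mul_eq_mul_div]
    exact div_le_div_of_nonneg_right (by linarith) (le_of_lt hε)
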